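/- Let $\mathbb{K}$ be an algebraically closed field. Varieties are understood classically, as sets of $\mathbb{K}$-points with their Zariski topology and regular functions. Let $n,k\ge 0$ and $d\ge 1$, and let $f_1,\dots,f_k,h_1,\dots,h_k\in\mathbb{K}[T_0,\dots,T_n]$ be homogeneous of degree $d$ such that not all $f_i$ are zero and the tuple $(h_1,\dots,h_k)$ is not a scalar multiple of $(f_1,\dots,f_k)$. Let $X=\{x\in\mathbb{P}^n(\mathbb{K}) : f_1(x)=\dots=f_k(x)=0\}$ and $D_+(\overline h_j)=\{x\in X : h_j(x)\neq 0\}$. For $e\ge 0$ let $M_{n,e}=\{\mathbf m\in\mathbb{N}_0^{n+1} : \sum_j m_j=e\}$, and let $\nu\colon\mathbb{P}^n\to\mathbb{P}(\mathbb{K}^{M_{n,d}})$, $[x]\mapsto[x^{\mathbf m}]_{\mathbf m}$, be the $d$-th Veronese embedding. Let $Q$ be the quiver with vertices $1,2,3$, with $n+1$ arrows from $2$ to $3$ and $k$ arrows from $2$ to $1$. Let $V$ be the representation of $Q$ with $V_1=\mathbb{K}$, $V_2=\mathbb{K}^{M_{n,d}}$, $V_3=\mathbb{K}^{M_{n,d-1}}$,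 where the $j$-th arrow $2\to 3$ ($0\le j\le n$) acts by $v_{\mathbf m}\mapsto v_{\mathbf m-\mathbf e_j}$ if $m_j>0$ and $v_{\mathbf m}\mapsto 0$ otherwise, and the $i$-th arrow $2\to 1$ acts by $v_{\mathbf m}\mapsto$ the coefficient of $T^{\mathbf m}$ in $f_i$. Let $W$ be defined in the same way with $h_i$ in place of $f_i$. Let $\mathcal{E}={}^{\perp}W$ be the full subcategory of the finite-dimensional representations $M$ with $\operatorname{Hom}_Q(M,W)=0$. For a dimension vector $\mathbf d$, let $\mathrm{Gr}_Q(\mathbf d,V)$ be the variety of $\mathbf d$-dimensional subrepresentations of $V$, and let $\mathrm{Gr}_{\mathcal E}(\mathbf d,V)\subseteq \mathrm{Gr}_Q(\mathbf d,V)$ consist of those $U$ with $U\in\mathcal{E}$ and $V/U\in\mathcal{E}$. A full subcategory of the category of finite-dimensional representations is called open fully exact if it is closed under isomorphisms, finite direct sums, direct summands and extensions, and if for each dimension vector the representations belonging to it form a Zariski open subset of the representation space. (a) $V$ and $W$ are bricks with $\operatorname{Hom}_Q(V,W)=0=\operatorname{Hom}_Q(W,V)$; the subcategory $\mathcal{E}$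 is open fully exact; and $V\in\mathcal{E}$. (b) There is an isomorphism of varieties $\Phi\colon\mathrm{Gr}_Q((0,1,1),V)\to X$ with $\nu(\Phi(U))=U_2$ for all $U$ (Reineke's isomorphism). The subsets $\mathrm{Gr}_{\mathcal E}((0,1,1),V)\subseteq\mathrm{Gr}_Q((0,1,1),V)$ and $\bigcup_{j=1}^k D_+(\overline h_j)\subseteq X$ are open, and $\Phi$ restricts to an isomorphism of varieties $\mathrm{Gr}_{\mathcal E}((0,1,1),V)\to\bigcup_{j=1}^k D_+(\overline h_j)$. (c) Consequently, every quasi-projective variety over $\mathbb{K}$ (a locally closed subset of some $\mathbb{P}^n(\mathbb{K})$) is isomorphic to $\mathrm{Gr}_{{}^{\perp}W}(\mathbf d,V)$ for some finite acyclic quiver with three vertices, some bricks $V$ and $W$ such that ${}^{\perp}W$ is open fully exact and contains $V$, and some dimension vector $\mathbf d$ all of whose entries are at most $1$. -/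

import Mathlib

open scoped LinearAlgebra.Projectivization Topology

universe u v w

/-! ### Classical varieties as spaces with functions

A classical variety over `K` is handled as the set of its `K`-points together with its Zariski
topology and, for each open set `U`, the set of regular functions on `U`. The only spaces that
occur are built from affine spaces by passing to subsets and to quotients. -/

/-- A set `X` with a topology and, for every open `U`, a notion of a `K`-valued function being
regular on `U` (only the values of the function on `U` are relevant). -/
structure FunSpace (K : Type u) (X : Type v) where
  top : TopologicalSpace X
  reg : Set X → (X → K) → Prop

namespace FunSpace

variable {K : Type u} [Field K] {X : Type v} {Y : Type w}

/-- The structure on a subset (or along a map `i : X → Y`): subspace topology, and the functions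
that locally extend to regular functions on open subsets of `Y`. -/
def induced (B : FunSpace K Y) (i : X → Y) : FunSpace K X where
  top := B.top.induced i
  reg := fun U f => ∀ x ∈ U, ∃ (O : Set Y) (g : Y → K), IsOpen[B.top] O ∧ i x ∈ O ∧
    B.reg O g ∧ ∀ y ∈ U, i y ∈ O → f y = g (i y)

/-- The quotient structure along a surjection `q : X → Y`: quotient topology, and a function on `Y`
is regular on `U` when its pull-back is regular on the preimage of `U`. -/
def coinduced (A : FunSpace K X) (q : X → Y) : FunSpace K Y where
  top := A.top.coinduced q
  reg := fun U f => A.reg (q ⁻¹' U) (f ∘ q)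

/-- A bijection is an isomorphism when it is a homeomorphism under which the regular functions on
corresponding open sets correspond. -/
structure IsIso (A : FunSpace K X) (B : FunSpace K Y) (e : X ≃ Y) : Prop where
  isOpen_iff : ∀ U : Set Y, IsOpen[B.top] U ↔ IsOpen[A.top] (e ⁻¹' U)
  reg_iff : ∀ (U : Set Y) (f : Y → K), IsOpen[B.top] U →
    (B.reg U f ↔ A.reg (e ⁻¹' U) (f ∘ e))

end FunSpace

/-- Polynomial functions on a vector space: the algebra generated by the linear forms. -/
def polyFun (K : Type u) [Field K] (E : Type v) [AddCommGroup E] [Module K E] :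
    Subalgebra K (E → K) :=
  Algebra.adjoin K (Set.range fun l : Module.Dual K E => (l : E → K))

/-- A finite-dimensional vector space as an affine space: Zariski topology, and the functions that
are locally quotients of polynomial functions. -/
def affineSpace (K : Type u) [Field K] (E : Type v) [AddCommGroup E] [Module K E] :
    FunSpace K E where
  top := TopologicalSpace.generateFrom {O | ∃ p ∈ polyFun K E, O = {x | p x ≠ 0}}
  reg := fun U f => ∀ x ∈ U, ∃ p ∈ polyFun K E, ∃ q ∈ polyFun K E, q x ≠ 0 ∧
    ∀ y ∈ U, q y ≠ 0 → f y = p y / q y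

/-- The projective space of a finite-dimensional vector space, as the quotient of the punctured
affine space. -/
def projSpace (K : Type u) [Field K] (E : Type v) [AddCommGroup E] [Module K E] :
    FunSpace K (ℙ K E) :=
  ((affineSpace K E).induced (Subtype.val : {x : E // x ≠ 0} → E)).coinduced
    (Projectivization.mk' K)

/-! ### Quiver representations -/

/-- Finite-dimensional representations of a quiver over `K`. -/
structure QRep (K : Type u) [Field K] (Q : Type) [Quiver.{0} Q] where
  obj : Q → Type u
  [grp : ∀ i, AddCommGroup (obj i)]
  [mod : ∀ i, Module K (obj i)]
  [fin : ∀ i, FiniteDimensional K (obj i)]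
  map : ∀ {i j : Q}, (i ⟶ j) → obj i →ₗ[K] obj j

attribute [instance] QRep.grp QRep.mod QRep.fin

namespace QRep

variable {K : Type u} [Field K] {Q : Type} [Quiver.{0} Q]

/-- Morphisms of representations. -/
structure Hom (M N : QRep K Q) where
  app : ∀ i, M.obj i →ₗ[K] N.obj i
  comm : ∀ {i j : Q} (a : i ⟶ j) (x : M.obj i), app j (M.map a x) = N.map a (app i x)

/-- `Hom(M, N) = 0`. -/
def HomZero (M N : QRep K Q) : Prop := ∀ φ : Hom M N, ∀ i, φ.app i = 0

/-- A brick: a nonzero representation all of whose nonzero endomorphisms are invertible. -/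
def IsBrick (M : QRep K Q) : Prop :=
  (∃ i, Nontrivial (M.obj i)) ∧
    ∀ φ : Hom M M, (∃ i, φ.app i ≠ 0) → ∀ i, Function.Bijective (φ.app i)

/-- The full subcategory `{}^⊥ W` of representations `X` with `Hom(X, W) = 0`. -/
def leftPerp (W : QRep K Q) : QRep K Q → Prop := fun X => HomZero X W

/-- Direct sum of two representations. -/
def sum (M N : QRep K Q) : QRep K Q where
  obj := fun i => M.obj i × N.obj i
  map := fun a => (M.map a).prodMap (N.map a)

/-- The representation space `R_d(Q) = ⨁_{a : i → j} K^{d_j × d_i}`. -/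
abbrev Space (K : Type u) [Field K] (Q : Type) [Quiver.{0} Q] (d : Q → ℕ) : Type u :=
  ∀ i j : Q, (i ⟶ j) → ((Fin (d i) → K) →ₗ[K] (Fin (d j) → K))

/-- The representation given by a point of `R_d(Q)`. -/
def ofSpace {d : Q → ℕ} (M : Space K Q d) : QRep K Q where
  obj := fun i => Fin (d i) → K
  map := fun {i j} a => M i j a

/-- A full subcategory (given by a predicate on objects) that is additively closed (closed under
isomorphisms, finite direct sums and direct summands), closed under extensions, and open, that is,
the points of `R_d(Q)` lying in it form a Zariski open subset for every dimension vector `d`. -/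
structure IsOpenFullyExact (P : QRep K Q → Prop) : Prop where
  iso : ∀ (M N : QRep K Q) (φ : Hom M N), (∀ i, Function.Bijective (φ.app i)) → P M → P N
  zero : ∀ M : QRep K Q, (∀ i, Subsingleton (M.obj i)) → P M
  sum_iff : ∀ M N : QRep K Q, P (M.sum N) ↔ P M ∧ P N
  ext : ∀ (A B C : QRep K Q) (f : Hom A B) (g : Hom B C),
    (∀ i, Function.Injective (f.app i)) → (∀ i, Function.Surjective (g.app i)) →
    (∀ i, LinearMap.range (f.app i) = LinearMap.ker (g.app i)) → P A → P C → P B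
  isOpen : ∀ d : Q → ℕ, IsOpen[(affineSpace K (Space K Q d)).top] {M | P (ofSpace M)}

/-- Subrepresentations. -/
structure Sub (M : QRep K Q) where
  carrier : ∀ i, Submodule K (M.obj i)
  stable : ∀ {i j : Q} (a : i ⟶ j), carrier i ≤ (carrier j).comap (M.map a)

/-- A subrepresentation `U` as a representation. -/
def Sub.toRep {M : QRep K Q} (U : M.Sub) : QRep K Q where
  obj := fun i => U.carrier i
  map := fun a => (M.map a).restrict (U.stable a)

/-- The quotient representation `M / U`. -/
def Sub.quot {M : QRep K Q} (U : M.Sub) : QRep K Q where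
  obj := fun i => M.obj i ⧸ U.carrier i
  map := fun {i j} a => (U.carrier i).mapQ (U.carrier j) (M.map a) (U.stable a)

/-- The set of `e`-dimensional subrepresentations of `M`. -/
def Gr (e : Q → ℕ) (M : QRep K Q) : Type u :=
  {U : M.Sub // ∀ i, Module.finrank K (U.carrier i) = e i}

/-- Inflations with target `M` and source in `R_e(Q)`: pairs `(U, f)` of a point `U` of `R_e(Q)` and
a monomorphism of representations `f : U → M`. -/
def Infl (e : Q → ℕ) (M : QRep K Q) :
    Set (Space K Q e × (∀ i, (Fin (e i) → K) →ₗ[K] M.obj i)) :=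
  {p | (∀ i, Function.Injective (p.2 i)) ∧
    ∀ (i j : Q) (a : i ⟶ j) (x : Fin (e i) → K), M.map a (p.2 i x) = p.2 j (p.1 i j a x)}

/-- The map sending `(U, f)` to the image of `f`. It is surjective, and its fibres are the orbits of
`∏ GL_{e_i}(K)`, acting by change of basis of the source. -/
def Infl.toGr {e : Q → ℕ} {M : QRep K Q} (p : Infl e M) : Gr e M :=
  ⟨{ carrier := fun i => LinearMap.range (p.1.2 i)
     stable := by
      rintro i j a _ ⟨x, rfl⟩
      exact ⟨p.1.1 i j a x, (p.2.2 i j a x).symm⟩ },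
    fun i => by
      simpa using LinearMap.finrank_range_of_inj (p.2.1 i)⟩

/-- The quiver Grassmannian as a variety: the quotient of the variety of inflations by the group
`∏ GL_{e_i}(K)`. -/
def grSpace (e : Q → ℕ) (M : QRep K Q) : FunSpace K (Gr e M) :=
  ((affineSpace K (Space K Q e × (∀ i, (Fin (e i) → K) →ₗ[K] M.obj i))).induced
    (Subtype.val : Infl e M → _)).coinduced Infl.toGr

/-- The Grassmannian of the exact category given by `P`: the subrepresentations `U` of `M` with both
`U` and `M / U` in it. -/
def grSub (P : QRep K Q → Prop) (e : Q → ℕ) (M : QRep K Q) : Set (Gr e M) :=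
  {U | P U.1.toRep ∧ P U.1.quot}

/-- The variety structure on the Grassmannian of an exact category, as a subset of the quiver
Grassmannian. -/
def grSubSpace (P : QRep K Q → Prop) (e : Q → ℕ) (M : QRep K Q) : FunSpace K (grSub P e M) :=
  (grSpace e M).induced Subtype.val

end QRep

/-! ### The quiver and the representations built from equations -/

/-- The exponents of the monomials of degree `d` in `n + 1` variables. -/
def Exps (n d : ℕ) : Type := {m : Fin (n + 1) →₀ ℕ // ∑ i, m i = d}

instance (n d : ℕ) : DecidableEq (Exps n d) :=
  inferInstanceAs (DecidableEq {m : Fin (n + 1) →₀ ℕ // ∑ i, m i = d})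

instance (n d : ℕ) : Fintype (Exps n d) :=
  Fintype.subtype (Finset.finsuppAntidiag Finset.univ d) (by
    intro m
    simp [Finset.mem_finsuppAntidiag])

noncomputable section

/-- Lowering the `j`-th exponent by one. -/
def Exps.lower {n d : ℕ} (m : Exps n d) (j : Fin (n + 1)) (h : 0 < m.1 j) : Exps n (d - 1) :=
  ⟨m.1 - Finsupp.single j 1, by
    have h1 : m.1 = (m.1 - Finsupp.single j 1) + Finsupp.single j 1 := by
      ext i
      by_cases hi : j = i
      · subst hi
        simp
        omega
      · simp [hi]
    have h2 : ∑ i, m.1 i =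
        ∑ i, (m.1 - Finsupp.single j 1 : Fin (n + 1) →₀ ℕ) i + ∑ i, (Finsupp.single j 1 : Fin (n + 1) →₀ ℕ) i := by
      rw [← Finset.sum_add_distrib]
      exact Finset.sum_congr rfl fun i _ => DFunLike.congr_fun h1 i
    have h3 : ∑ i, (Finsupp.single j 1 : Fin (n + 1) →₀ ℕ) i = 1 := by
      simp [Finsupp.single_apply]
    have h4 := m.2
    omega⟩

/-- The three vertices of the quiver. -/
inductive Vert (n k : ℕ) : Type
  | one : Vert n k
  | two : Vert n k
  | three : Vert n k

/-- `n + 1` arrows from `2` to `3`, `k` arrows from `2` to `1`, and no others. -/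
def Vert.Arrow {n k : ℕ} : Vert n k → Vert n k → Type
  | .two, .three => Fin (n + 1)
  | .two, .one => Fin k
  | _, _ => Empty

instance (n k : ℕ) : Quiver.{0} (Vert n k) where
  Hom := Vert.Arrow

/-- The dimension vector `(0, 1, 1)`. -/
def dimVec {n k : ℕ} : Vert n k → ℕ
  | .one => 0
  | .two => 1
  | .three => 1

/-- The linear form on `K^{M_{n,d}}` sending the basis vector of `m` to the coefficient of `T^m`. -/
def coeffForm {K : Type u} [Field K] (n d : ℕ) (f : MvPolynomial (Fin (n + 1)) K) :
    (Exps n d → K) →ₗ[K] K :=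
  (Pi.basisFun K (Exps n d)).constr K fun m => MvPolynomial.coeff m.1 f

/-- The linear map `K^{M_{n,d}} → K^{M_{n,d-1}}` sending `v_m` to `v_{m - e_j}` if `m_j > 0` and to
`0` otherwise. -/
def lowerMap (K : Type u) [Field K] (n d : ℕ) (j : Fin (n + 1)) :
    (Exps n d → K) →ₗ[K] (Exps n (d - 1) → K) :=
  (Pi.basisFun K (Exps n d)).constr K fun m =>
    if h : 0 < m.1 j then Pi.single (m.lower j h) 1 else 0

/-- The spaces `K`, `K^{M_{n,d}}`, `K^{M_{n,d-1}}` at the vertices `1`, `2`, `3` (each written as the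
space of functions on a finite set). -/
def Vert.Index {n k : ℕ} (d : ℕ) : Vert n k → Type
  | .one => Unit
  | .two => Exps n d
  | .three => Exps n (d - 1)

instance {n k : ℕ} (d : ℕ) (i : Vert n k) : Fintype (i.Index d) :=
  match i with
  | .one => inferInstanceAs (Fintype Unit)
  | .two => inferInstanceAs (Fintype (Exps n d))
  | .three => inferInstanceAs (Fintype (Exps n (d - 1)))

/-- The representation attached to `k` forms of degree `d`: the arrows from `2` to `3` act by the
lowering maps, and the arrows from `2` to `1` by the coefficient forms of the given polynomials. -/
def eqnRep {K : Type u} [Field K] {n k : ℕ} (d : ℕ) (f : Fin k → MvPolynomial (Fin (n + 1)) K) :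
    QRep K (Vert n k) where
  obj := fun i => i.Index d → K
  map := fun {i j} =>
    match i, j with
    | .two, .three => fun (a : Fin (n + 1)) => lowerMap K n d a
    | .two, .one => fun (a : Fin k) => LinearMap.pi fun _ => coeffForm n d (f a)
    | .one, _ => fun a => nomatch a
    | .three, _ => fun a => nomatch a
    | .two, .two => fun a => nomatch a

/-! ### Projective varieties and the Veronese embedding -/

/-- Projective `n`-space. -/
abbrev PP (K : Type u) [Field K] (n : ℕ) : Type u := ℙ K (Fin (n + 1) → K)

/-- The variety structure on a (locally closed) subset of projective space. -/
def subspaceOfPP {K : Type u} [Field K] {n : ℕ} (Y : Set (PP K n)) : FunSpace K Y :=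
  (projSpace K (Fin (n + 1) → K)).induced Subtype.val

/-- The projective variety in `PP K n` given by the (homogeneous) equations `f i = 0`. -/
def projVariety {K : Type u} [Field K] {n k : ℕ} (f : Fin k → MvPolynomial (Fin (n + 1)) K) :
    Set (PP K n) :=
  {x | ∀ i, MvPolynomial.eval x.rep (f i) = 0}

/-- The subset `⋃ D_+(h j)` of a subset of `PP K n`: the points where some (homogeneous) `h j` does
not vanish. -/
def nonVanishing {K : Type u} [Field K] {n k : ℕ} (X : Set (PP K n))
    (h : Fin k → MvPolynomial (Fin (n + 1)) K) : Set X :=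
  {x | ∃ j, MvPolynomial.eval x.1.rep (h j) ≠ 0}

/-- The vector of all monomials of degree `d`. -/
def monomials {K : Type u} [Field K] {n : ℕ} (d : ℕ) (x : Fin (n + 1) → K) : Exps n d → K :=
  fun m => ∏ i, x i ^ m.1 i

theorem monomials_ne_zero {K : Type u} [Field K] {n : ℕ} (d : ℕ) {x : Fin (n + 1) → K}
    (hx : x ≠ 0) : monomials d x ≠ 0 := by
  obtain ⟨i, hi⟩ := Function.ne_iff.mp hx
  intro h0
  have h1 := congrFun h0 ⟨Finsupp.single i d, by simp [Finsupp.single_apply]⟩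
  have h2 : ∏ j, x j ^ (Finsupp.single i d : Fin (n + 1) →₀ ℕ) j = x i ^ d := by
    rw [Finset.prod_eq_single i]
    · simp
    · intro j _ hj
      simp [hj.symm]
    · simp
  have h3 : x i ^ d = 0 := by
    rw [← h2]
    exact h1
  exact pow_ne_zero d hi h3

/-- The `d`-th Veronese embedding `[x] ↦ [x^m]_m` (the value does not depend on the representative
of the point). -/
def veronese {K : Type u} [Field K] {n : ℕ} (d : ℕ) (x : PP K n) : ℙ K (Exps n d → K) :=
  Projectivization.mk K (monomials d x.rep) (monomials_ne_zero d x.rep_nonzero)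

end

/-! A subrepresentation of `V` of dimension `(0, 1, 1)` is a line `⟨v⟩` at vertex 2 inside the
common kernel of the arrows `2 → 1`, together with a line `⟨w⟩` at vertex 3 such that the `j`-th
lowering map sends `v` to `x j • w` for some scalars `x j`. Comparing coefficients forces `v` and
`w` to be the same multiple of the vectors of monomials of `x` of degrees `d` and `d - 1`
(`eq_smul_monomials`), and `f i` then vanishes at `x`. This gives the bijection with `X`. It is an
isomorphism because in one direction `x` is read off linearly from the arrows of an inflation, and
in the other the monomials depend polynomially on a representative, which can be chosen regularly on
each affine chart.

The lowering maps have only scalar endomorphisms (`eq_smul_of_comm_lowerMap`). A morphism `V → W` is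
therefore a scalar `c` at vertices 2 and 3 and a scalar `μ` at vertex 1 with `μ • f = c • h`
(`eqnRep_hom`), and the brick and orthogonality statements are read off from this equation. Openness
of `leftPerp W` holds because it is the injectivity of a linear map that depends on the
representation in an affine way.

If `V` lies in `leftPerp W`, so does every quotient of `V`, and only the condition on `U` matters.
By the same computation with monomials, a nonzero morphism `U → W` exists exactly when all `h j`
vanish at the point of `U` (`pointGr_mem_grSub_iff`).

For a quasi-projective variety, both the closed part and the complement of the open part are cut out
by forms of one common degree. One extra variable makes the non-degeneracy conditions on `f` and `h`
hold (`exists_forms_of_isLocallyClosed`). -/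

/-! ### Morphisms of spaces with functions -/

namespace FunSpace

variable {K : Type u} {X : Type*} {Y : Type*} {Z : Type*}

/-- A map is a morphism when it is continuous and pulls regular functions on open sets back to
regular functions. -/
structure IsMor (A : FunSpace K X) (B : FunSpace K Y) (φ : X → Y) : Prop where
  isOpen : ∀ U : Set Y, IsOpen[B.top] U → IsOpen[A.top] (φ ⁻¹' U)
  reg : ∀ (U : Set Y) (f : Y → K), IsOpen[B.top] U → B.reg U f → A.reg (φ ⁻¹' U) (f ∘ φ)

/-- Regularity is a local condition: a function that locally agrees with regular functions is
regular. -/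
def IsLocal (A : FunSpace K X) : Prop :=
  ∀ (U : Set X) (f : X → K),
    (∀ x ∈ U, ∃ (O V : Set X) (g : X → K), IsOpen[A.top] O ∧ x ∈ O ∧ U ∩ O ⊆ V ∧ A.reg V g ∧
      ∀ y ∈ U ∩ O, f y = g y) → A.reg U f

theorem IsLocal.congr {A : FunSpace K X} (hA : A.IsLocal) {U V : Set X} {f g : X → K}
    (hg : A.reg V g) (hUV : U ⊆ V) (hfg : ∀ y ∈ U, f y = g y) : A.reg U f :=
  hA U f fun _ _ => ⟨Set.univ, V, g, @isOpen_univ X A.top, trivial,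
    fun _ hy => hUV hy.1, hg, fun y hy => hfg y hy.1⟩

theorem IsLocal.induced {B : FunSpace K Y} (hB : B.IsLocal) (i : X → Y) :
    (B.induced i).IsLocal := by
  intro U f h x hx
  obtain ⟨O, V, g, ⟨O', hO', rfl⟩, hxO, hV, hg, hfg⟩ := h x hx
  obtain ⟨O₁, g₁, hO₁, hxO₁, hg₁, hgg₁⟩ := hg x (hV ⟨hx, hxO⟩)
  refine ⟨O' ∩ O₁, g₁, @IsOpen.inter Y B.top _ _ hO' hO₁, ⟨hxO, hxO₁⟩,
    hB.congr hg₁ Set.inter_subset_right fun _ _ => rfl, fun y hy hyO => ?_⟩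
  rw [hfg y ⟨hy, hyO.1⟩]
  exact hgg₁ y (hV ⟨hy, hyO.1⟩) hyO.2

theorem IsLocal.coinduced {A : FunSpace K X} (hA : A.IsLocal) (q : X → Y) :
    (A.coinduced q).IsLocal := by
  intro U f h
  refine hA _ _ fun x hx => ?_
  obtain ⟨O, V, g, hO, hxO, hV, hg, hfg⟩ := h (q x) hx
  exact ⟨q ⁻¹' O, q ⁻¹' V, g ∘ q, hO, hxO, fun y hy => hV hy, hg, fun y hy => hfg (q y) hy⟩

theorem IsMor.comp {A : FunSpace K X} {B : FunSpace K Y} {C : FunSpace K Z} {ψ : Y → Z}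
    {φ : X → Y} (hψ : IsMor B C ψ) (hφ : IsMor A B φ) : IsMor A C (ψ ∘ φ) where
  isOpen U hU := hφ.isOpen _ (hψ.isOpen U hU)
  reg U f hU hf := hφ.reg _ _ (hψ.isOpen U hU) (hψ.reg U f hU hf)

theorem isMor_induced (B : FunSpace K Y) (i : X → Y) : IsMor (B.induced i) B i where
  isOpen U hU := ⟨U, hU, rfl⟩
  reg U f hU hf _ hx := ⟨U, f, hU, hx, hf, fun _ _ _ => rfl⟩

theorem isMor_coinduced (A : FunSpace K X) (q : X → Y) : IsMor A (A.coinduced q) q where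
  isOpen _ hU := hU
  reg _ _ _ hf := hf

/-- Universal property of a subspace. Locality of `A` is what glues the pull-backs of the local
extensions by which induced regularity is defined. -/
theorem IsMor.to_induced {A : FunSpace K X} {B : FunSpace K Y} {i : Z → Y} {φ : X → Z}
    (hA : A.IsLocal) (h : IsMor A B (i ∘ φ)) : IsMor A (B.induced i) φ where
  isOpen := by
    rintro _ ⟨O, hO, rfl⟩
    exact h.isOpen O hO
  reg U f _ hf := by
    refine hA _ _ fun x hx => ?_
    obtain ⟨O, g, hO, hxO, hg, hfg⟩ := hf (φ x) hx
    exact ⟨_, _, _, h.isOpen O hO, hxO, Set.inter_subset_right, h.reg O g hO hg,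
      fun y hy => hfg (φ y) hy.1 hy.2⟩

theorem IsMor.of_comp_coinduced {A : FunSpace K X} {B : FunSpace K Z} {q : X → Y} {φ : Y → Z}
    (h : IsMor A B (φ ∘ q)) : IsMor (A.coinduced q) B φ where
  isOpen := h.isOpen
  reg := h.reg

theorem IsMor.id (A : FunSpace K X) : IsMor A A id where
  isOpen _ hU := hU
  reg _ _ _ hf := hf

/-- Removes an iterated subspace structure, so that a piece of the punctured space can be treated as
a subset of the affine space itself. -/
theorem IsMor.of_induced_comp {A : FunSpace K X} {B : FunSpace K Y} {i : Z → X} {S : Type*}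
    {j : S → Z} {φ : S → Y} (hA : A.IsLocal) (h : IsMor (A.induced (i ∘ j)) B φ) :
    IsMor ((A.induced i).induced j) B φ :=
  h.comp (φ := _root_.id) (.to_induced ((hA.induced _).induced _)
    ((isMor_induced A i).comp (isMor_induced _ j)))

/-- Being a morphism can be checked on an open cover. -/
theorem IsMor.of_cover {ι : Type*} {A : FunSpace K X} {B : FunSpace K Y} {φ : X → Y}
    (hA : A.IsLocal) (S : ι → Set X) (hS : ∀ i, IsOpen[A.top] (S i)) (hcov : ∀ x, ∃ i, x ∈ S i)
    (h : ∀ i, IsMor (A.induced (Subtype.val : S i → X)) B (φ ∘ Subtype.val)) :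
    IsMor A B φ where
  isOpen U hU := by
    let := A.top
    refine isOpen_iff_forall_mem_open.2 fun x hx => ?_
    obtain ⟨i, hi⟩ := hcov x
    obtain ⟨O, hO, hO'⟩ := (h i).isOpen U hU
    refine ⟨O ∩ S i, fun y hy => ?_, IsOpen.inter hO (hS i), ?_, hi⟩
    · exact (Set.ext_iff.1 hO' ⟨y, hy.2⟩).1 hy.1
    · exact (Set.ext_iff.1 hO' ⟨x, hi⟩).2 hx
  reg U f hU hf := by
    refine hA _ _ fun x hx => ?_
    obtain ⟨i, hi⟩ := hcov x
    obtain ⟨O, g, hO, hxO, hg, hfg⟩ := (h i).reg U f hU hf ⟨x, hi⟩ hx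
    exact ⟨O ∩ S i, O, g, @IsOpen.inter X A.top _ _ hO (hS i), ⟨hxO, hi⟩, fun y hy => hy.2.1, hg,
      fun y hy => hfg ⟨y, hy.2.2⟩ hy.1 hy.2.1⟩

/-- On an open subset of a quotient, the subspace structure is the quotient structure. -/
theorem IsMor.of_comp_coinduced_restrict [Zero K] {A : FunSpace K X} {B : FunSpace K Z} {q : X → Y}
    {D : Set Y} {φ : D → Z} (hA : A.IsLocal)
    (hD : IsOpen[A.top] (q ⁻¹' D))
    (h : IsMor (A.induced (Subtype.val : q ⁻¹' D → X)) B fun x => φ ⟨q x.1, x.2⟩) :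
    IsMor ((A.coinduced q).induced (Subtype.val : D → Y)) B φ := by
  classical
  -- A subset of `D` is open in `Y` once its preimage in `X` is open. Here that preimage is the
  -- intersection of two open sets.
  have key : ∀ U, IsOpen[B.top] U → IsOpen[A.top] (q ⁻¹' (Subtype.val '' (φ ⁻¹' U))) := by
    intro U hU
    obtain ⟨O, hO, hO'⟩ := h.isOpen U hU
    have : q ⁻¹' (Subtype.val '' (φ ⁻¹' U)) = O ∩ q ⁻¹' D := by
      ext x
      constructor
      · rintro ⟨y, hy, hyx⟩
        have hx : x ∈ q ⁻¹' D := by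
          rw [Set.mem_preimage, ← hyx]
          exact y.2
        refine ⟨(Set.ext_iff.1 hO' ⟨x, hx⟩).2 ?_, hx⟩
        have : y = ⟨q x, hx⟩ := Subtype.ext hyx
        rw [this] at hy
        exact hy
      · rintro ⟨hx, hxD⟩
        exact ⟨⟨q x, hxD⟩, (Set.ext_iff.1 hO' ⟨x, hxD⟩).1 hx, rfl⟩
    rw [this]
    exact @IsOpen.inter X A.top _ _ hO hD
  refine ⟨fun U hU => ⟨_, key U hU, Set.preimage_image_eq _ Subtype.val_injective⟩,
    fun U f hU hf y hy => ?_⟩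
  -- The extension by zero outside `D` is harmless, since regularity is only claimed on a set
  -- contained in `D`.
  refine ⟨Subtype.val '' (φ ⁻¹' U), fun z => if hz : z ∈ D then f (φ ⟨z, hz⟩) else 0, key U hU,
    ⟨y, hy, rfl⟩, ?_, fun z hz _ => by simp⟩
  refine hA _ _ fun x hx => ?_
  have hmem : ∀ x, x ∈ q ⁻¹' (Subtype.val '' (φ ⁻¹' U)) → ∃ hx : q x ∈ D, φ ⟨q x, hx⟩ ∈ U := by
    rintro x ⟨y, hy, hyx⟩
    have hx : q x ∈ D := hyx ▸ y.2
    have : y = ⟨q x, hx⟩ := Subtype.ext hyx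
    rw [this] at hy
    exact ⟨hx, hy⟩
  obtain ⟨hxD, hxU⟩ := hmem x hx
  obtain ⟨O, g, hO, hxO, hg, hfg⟩ := h.reg U f hU hf ⟨x, hxD⟩ hxU
  refine ⟨O, O, g, hO, hxO, Set.inter_subset_right, hg, fun z hz => ?_⟩
  obtain ⟨hzD, hzU⟩ := hmem z hz.1
  have := hfg ⟨z, hzD⟩ hzU hz.2
  simpa [hzD] using this

theorem IsIso.of_isMor {A : FunSpace K X} {B : FunSpace K Y} {e : X ≃ Y} (h : IsMor A B e)
    (h' : IsMor B A e.symm) : IsIso A B e where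
  isOpen_iff U := by
    refine ⟨h.isOpen U, fun hU => ?_⟩
    have := h'.isOpen _ hU
    rwa [← Set.preimage_comp, e.self_comp_symm, Set.preimage_id] at this
  reg_iff U f hU := by
    refine ⟨h.reg U f hU, fun hf => ?_⟩
    have := h'.reg _ _ (h.isOpen U hU) hf
    rwa [← Set.preimage_comp, Function.comp_assoc, e.self_comp_symm, Set.preimage_id] at this

theorem IsIso.isMor {A : FunSpace K X} {B : FunSpace K Y} {e : X ≃ Y} (h : IsIso A B e) :
    IsMor A B e where
  isOpen U hU := (h.isOpen_iff U).1 hU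
  reg U f hU hf := (h.reg_iff U f hU).1 hf

theorem IsIso.isMor_symm {A : FunSpace K X} {B : FunSpace K Y} {e : X ≃ Y} (h : IsIso A B e) :
    IsMor B A e.symm where
  isOpen U hU := by
    rw [h.isOpen_iff, ← Set.preimage_comp, e.symm_comp_self, Set.preimage_id]
    exact hU
  reg U f hU hf := by
    rw [h.reg_iff, ← Set.preimage_comp, Function.comp_assoc, e.symm_comp_self, Set.preimage_id]
    · exact hf
    · rw [h.isOpen_iff, ← Set.preimage_comp, e.symm_comp_self, Set.preimage_id]
      exact hU

theorem IsIso.trans {A : FunSpace K X} {B : FunSpace K Y} {C : FunSpace K Z} {e : X ≃ Y}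
    {e' : Y ≃ Z} (h : IsIso A B e) (h' : IsIso B C e') : IsIso A C (e.trans e') :=
  .of_isMor (h'.isMor.comp h.isMor) (h.isMor_symm.comp h'.isMor_symm)

/-- An isomorphism restricts to isomorphisms between corresponding subsets. -/
theorem IsIso.restrict {A : FunSpace K X} {B : FunSpace K Y} (hA : A.IsLocal) (hB : B.IsLocal)
    {e : X ≃ Y} (h : IsIso A B e) {S : Set X} {T : Set Y} {ε : S ≃ T}
    (hε : ∀ x, (ε x).1 = e x.1) :
    IsIso (A.induced (Subtype.val : S → X)) (B.induced (Subtype.val : T → Y)) ε := by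
  refine .of_isMor (.to_induced (hA.induced _) ?_) (.to_induced (hB.induced _) ?_)
  · have : (Subtype.val ∘ ε : S → Y) = e ∘ Subtype.val := funext hε
    rw [this]
    exact h.isMor.comp (isMor_induced _ _)
  · have : (Subtype.val ∘ ε.symm : T → X) = e.symm ∘ Subtype.val := by
      funext y
      rw [Function.comp_apply, Function.comp_apply, Equiv.eq_symm_apply, ← hε,
        Equiv.apply_symm_apply]
    rw [this]
    exact h.isMor_symm.comp (isMor_induced _ _)

end FunSpace

/-! ### Affine spaces -/

section Affine

variable {K : Type u} [Field K] {E : Type*} [AddCommGroup E] [Module K E]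
  {F : Type*} [AddCommGroup F] [Module K F]

open FunSpace

theorem polyFun_dual (l : Module.Dual K E) : (fun x => l x) ∈ polyFun K E :=
  Algebra.subset_adjoin ⟨l, rfl⟩

theorem isOpen_ne_zero {p : E → K} (hp : p ∈ polyFun K E) :
    IsOpen[(affineSpace K E).top] {x | p x ≠ 0} :=
  TopologicalSpace.isOpen_generateFrom_of_mem ⟨p, hp, rfl⟩

/-- The principal open sets form a basis and not only a subbasis, because a product is nonzero
exactly where both factors are. -/
theorem exists_polyFun_of_isOpen {O : Set E} (hO : IsOpen[(affineSpace K E).top] O) :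
    ∀ x ∈ O, ∃ p ∈ polyFun K E, p x ≠ 0 ∧ ∀ y, p y ≠ 0 → y ∈ O := by
  induction hO with
  | basic s hs =>
    obtain ⟨p, hp, rfl⟩ := hs
    exact fun x hx => ⟨p, hp, hx, fun _ h => h⟩
  | univ => exact fun x _ => ⟨1, one_mem _, one_ne_zero, fun _ _ => trivial⟩
  | inter s t _ _ hs ht =>
    rintro x ⟨hxs, hxt⟩
    obtain ⟨p, hp, hpx, hp'⟩ := hs x hxs
    obtain ⟨q, hq, hqx, hq'⟩ := ht x hxt
    exact ⟨p * q, mul_mem hp hq, mul_ne_zero hpx hqx, fun y hy =>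
      ⟨hp' y (left_ne_zero_of_mul hy), hq' y (right_ne_zero_of_mul hy)⟩⟩
  | sUnion S _ ih =>
    rintro x ⟨s, hs, hxs⟩
    obtain ⟨p, hp, hpx, hp'⟩ := ih s hs x hxs
    exact ⟨p, hp, hpx, fun y hy => ⟨s, hs, hp' y hy⟩⟩

theorem affineSpace_isLocal : (affineSpace K E).IsLocal := by
  intro U f h x hx
  obtain ⟨O, V, g, hO, hxO, hV, hg, hfg⟩ := h x hx
  obtain ⟨p, hp, q, hq, hqx, hpq⟩ := hg x (hV ⟨hx, hxO⟩)
  obtain ⟨r, hr, hrx, hr'⟩ := exists_polyFun_of_isOpen hO x hxO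
  -- Expanding the fraction by `r` shrinks the locus of nonvanishing denominator into `O` without
  -- changing the value.
  refine ⟨p * r, mul_mem hp hr, q * r, mul_mem hq hr, mul_ne_zero hqx hrx, fun y hy hqr => ?_⟩
  have hqy : q y ≠ 0 := left_ne_zero_of_mul hqr
  have hry : r y ≠ 0 := right_ne_zero_of_mul hqr
  have hyO := hr' y hry
  rw [hfg y ⟨hy, hyO⟩, hpq y (hV ⟨hy, hyO⟩) hqy, Pi.mul_apply, Pi.mul_apply,
    mul_div_mul_right _ _ hry]

/-- A map from a subset of an affine space to an affine space is a morphism when its coordinates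
are quotients of polynomial functions. -/
theorem isMor_of_rational {S : Type*} {i : S → E} {φ : S → F}
    (h : ∀ l : Module.Dual K F, ∃ p ∈ polyFun K E, ∃ q ∈ polyFun K E,
      ∀ x, q (i x) ≠ 0 ∧ l (φ x) = p (i x) / q (i x)) :
    IsMor ((affineSpace K E).induced i) (affineSpace K F) φ := by
  -- Pulling back to a fraction with denominator nowhere zero on `S` is stable under sums and
  -- products, so it passes from linear forms to all polynomial functions.
  have h' : ∀ r ∈ polyFun K F, ∃ p ∈ polyFun K E, ∃ q ∈ polyFun K E,
      ∀ x, q (i x) ≠ 0 ∧ r (φ x) = p (i x) / q (i x) := by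
    intro r hr
    induction hr using Algebra.adjoin_induction with
    | mem r hr =>
      obtain ⟨l, rfl⟩ := hr
      exact h l
    | algebraMap c =>
      exact ⟨algebraMap K _ c, algebraMap_mem _ c, 1, one_mem _, fun x => by simp⟩
    | add r s _ _ hr hs =>
      obtain ⟨p, hp, q, hq, hpq⟩ := hr
      obtain ⟨p', hp', q', hq', hpq'⟩ := hs
      refine ⟨p * q' + q * p', add_mem (mul_mem hp hq') (mul_mem hq hp'), q * q', mul_mem hq hq',
        fun x => ⟨mul_ne_zero (hpq x).1 (hpq' x).1, ?_⟩⟩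
      simp [(hpq x).2, (hpq' x).2, div_add_div _ _ (hpq x).1 (hpq' x).1]
    | mul r s _ _ hr hs =>
      obtain ⟨p, hp, q, hq, hpq⟩ := hr
      obtain ⟨p', hp', q', hq', hpq'⟩ := hs
      refine ⟨p * p', mul_mem hp hp', q * q', mul_mem hq hq',
        fun x => ⟨mul_ne_zero (hpq x).1 (hpq' x).1, ?_⟩⟩
      simp [(hpq x).2, (hpq' x).2, div_mul_div_comm]
  refine ⟨fun U hU => ?_, fun U f _ hf x hx => ?_⟩
  · let := ((affineSpace K E).induced i).top
    refine isOpen_iff_forall_mem_open.2 fun x hx => ?_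
    obtain ⟨r, hr, hrx, hrU⟩ := exists_polyFun_of_isOpen hU _ hx
    obtain ⟨p, hp, q, hq, hpq⟩ := h' r hr
    refine ⟨i ⁻¹' {y | p y ≠ 0}, fun y hy => hrU _ ?_, ⟨_, isOpen_ne_zero hp, rfl⟩, ?_⟩
    · rw [(hpq y).2]
      exact div_ne_zero hy (hpq y).1
    · rw [(hpq x).2] at hrx
      exact fun h0 => hrx (by rw [h0, zero_div])
  · obtain ⟨r, hr, s, hs, hsx, hrs⟩ := hf _ hx
    obtain ⟨p, hp, q, hq, hpq⟩ := h' r hr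
    obtain ⟨p', hp', q', hq', hpq'⟩ := h' s hs
    have hne : ∀ y, s (φ y) ≠ 0 ↔ p' (i y) ≠ 0 := fun y => by
      rw [(hpq' y).2, div_ne_zero_iff]
      exact and_iff_left (hpq' y).1
    refine ⟨{y | (q * p') y ≠ 0}, fun y => (p * q') y / (q * p') y,
      isOpen_ne_zero (mul_mem hq hp'), mul_ne_zero (hpq x).1 ((hne x).1 hsx), ?_, ?_⟩
    · exact fun y hy => ⟨p * q', mul_mem hp hq', q * p', mul_mem hq hp', hy, fun _ _ _ => rfl⟩
    · intro y hy hyO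
      have hp'y : p' (i y) ≠ 0 := right_ne_zero_of_mul hyO
      rw [Function.comp_apply, hrs _ hy ((hne y).2 hp'y), (hpq y).2, (hpq' y).2, div_div_div_eq]
      rfl

/-- A map from a subset of an affine space to an affine space is a morphism when its coordinates
are polynomial functions. -/
theorem isMor_of_polynomial {S : Type*} {i : S → E} {φ : S → F}
    (h : ∀ l : Module.Dual K F, ∃ p ∈ polyFun K E, ∀ x, l (φ x) = p (i x)) :
    IsMor ((affineSpace K E).induced i) (affineSpace K F) φ :=
  isMor_of_rational fun l => by
    obtain ⟨p, hp, hpl⟩ := h l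
    exact ⟨p, hp, 1, one_mem _, fun x => by simp [hpl]⟩

theorem isMor_of_polyFun {φ : E → F} (h : ∀ l : Module.Dual K F, (fun x => l (φ x)) ∈ polyFun K E) :
    IsMor (affineSpace K E) (affineSpace K F) φ :=
  (isMor_of_polynomial (i := id) fun l => ⟨_, h l, fun _ => rfl⟩).comp
    (IsMor.to_induced affineSpace_isLocal (.id _))

theorem isMor_of_linear {S : Type*} {i : S → E} {φ : S → F} (L : E →ₗ[K] F)
    (h : ∀ x, φ x = L (i x)) :
    IsMor ((affineSpace K E).induced i) (affineSpace K F) φ :=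
  isMor_of_polynomial fun l => ⟨_, polyFun_dual (l ∘ₗ L), fun x => by rw [h]; rfl⟩

/-- Injectivity is an open condition on a family of linear maps that depends polynomially on a
parameter. -/
theorem isOpen_injective {G H : Type*} [AddCommGroup G] [Module K G] [FiniteDimensional K G]
    [AddCommGroup H] [Module K H] (T : E → G →ₗ[K] H)
    (hT : ∀ (x : G) (l : Module.Dual K H), (fun e => l (T e x)) ∈ polyFun K E) :
    IsOpen[(affineSpace K E).top] {e | Function.Injective (T e)} := by
  classical
  let := (affineSpace K E).top
  refine isOpen_iff_forall_mem_open.2 fun e he => ?_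
  -- With `S` a left inverse at the point `e`, the determinant of `S ∘ T e'` is polynomial in `e'`
  -- and equals one at `e`. Where it is nonzero, `T e'` is injective.
  obtain ⟨S, hS⟩ := (T e).exists_leftInverse_of_injective (LinearMap.ker_eq_bot.2 he)
  let b := Module.finBasis K G
  have hdet : (fun e' => (LinearMap.toMatrix b b (S ∘ₗ T e')).det) ∈ polyFun K E := by
    have : (fun e' => (LinearMap.toMatrix b b (S ∘ₗ T e')).det) =
        ∑ σ : Equiv.Perm (Fin (Module.finrank K G)), ((Equiv.Perm.sign σ : ℤ) : K) •
          ∏ i, fun e' => (b.coord (σ i) ∘ₗ S) (T e' (b i)) := by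
      funext e'
      rw [Matrix.det_apply']
      simp [LinearMap.toMatrix_apply]
    rw [this]
    exact sum_mem fun σ _ => Subalgebra.smul_mem _ (prod_mem fun i _ => hT _ _) _
  refine ⟨_, fun e' he' => ?_, isOpen_ne_zero hdet, ?_⟩
  · have hu : IsUnit (LinearMap.det (S ∘ₗ T e')) := by
      rw [← LinearMap.det_toMatrix b]
      exact isUnit_iff_ne_zero.2 he'
    have hinj : Function.Injective (S ∘ₗ T e') :=
      (LinearMap.equivOfDetNeZero _ hu.ne_zero).injective
    exact Function.Injective.of_comp (f := S) hinj
  · change (LinearMap.toMatrix b b (S ∘ₗ T e)).det ≠ 0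
    rw [hS, LinearMap.toMatrix_id, Matrix.det_one]
    exact one_ne_zero

theorem polyFun_eval {ι : Type*} (p : MvPolynomial ι K) :
    (fun x : ι → K => MvPolynomial.eval x p) ∈ polyFun K (ι → K) := by
  induction p using MvPolynomial.induction_on with
  | C a =>
    have : (fun x : ι → K => MvPolynomial.eval x (MvPolynomial.C a)) =
        algebraMap K ((ι → K) → K) a := by
      funext x
      simp
    rw [this]
    exact algebraMap_mem _ a
  | add p q hp hq =>
    simp only [map_add]
    exact add_mem hp hq
  | mul_X p i hp =>
    simp only [map_mul, MvPolynomial.eval_X]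
    exact mul_mem hp (polyFun_dual (LinearMap.proj i : (ι → K) →ₗ[K] K))

theorem exists_eval_of_polyFun {ι : Type*} [Finite ι] {p : (ι → K) → K}
    (hp : p ∈ polyFun K (ι → K)) : ∃ P : MvPolynomial ι K, ∀ x, p x = MvPolynomial.eval x P := by
  classical
  have := Fintype.ofFinite ι
  induction hp using Algebra.adjoin_induction with
  | mem r hr =>
    obtain ⟨l, rfl⟩ := hr
    refine ⟨∑ i, MvPolynomial.C (l (Pi.single i 1)) * MvPolynomial.X i, fun x => ?_⟩
    conv_lhs => rw [pi_eq_sum_univ' x]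
    simp [mul_comm]
  | algebraMap c => exact ⟨MvPolynomial.C c, fun x => by simp⟩
  | add r s _ _ hr hs =>
    obtain ⟨P, hP⟩ := hr
    obtain ⟨P', hP'⟩ := hs
    exact ⟨P + P', fun x => by simp [hP, hP']⟩
  | mul r s _ _ hr hs =>
    obtain ⟨P, hP⟩ := hr
    obtain ⟨P', hP'⟩ := hs
    exact ⟨P * P', fun x => by simp [hP, hP']⟩

end Affine

/-! ### Projective spaces -/

section Proj

variable {K : Type u} [Field K] {E : Type*} [AddCommGroup E] [Module K E]
  {F : Type*} [AddCommGroup F] [Module K F]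

open FunSpace

theorem projSpace_isLocal : (projSpace K E).IsLocal :=
  (affineSpace_isLocal.induced _).coinduced _

/-- The quotient map from the punctured affine space. -/
theorem isMor_mk' : IsMor ((affineSpace K E).induced (Subtype.val : {x : E // x ≠ 0} → E))
    (projSpace K E) (Projectivization.mk' K) :=
  isMor_coinduced _ _

/-- The affine chart where the `j`-th coordinate does not vanish. -/
def affineChart (K : Type u) [Field K] {ι : Type*} (j : ι) : Set (ℙ K (ι → K)) :=
  {x | x.rep j ≠ 0}

/-- The representative whose `j`-th coordinate is one. -/
noncomputable def normalizedRep {ι : Type*} (j : ι) (x : ℙ K (ι → K)) : ι → K :=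
  (x.rep j)⁻¹ • x.rep

theorem Projectivization.exists_rep_smul {v : E} (hv : v ≠ 0) :
    ∃ c : K, c ≠ 0 ∧ c • v = (Projectivization.mk K v hv).rep := by
  obtain ⟨a, ha⟩ := Projectivization.exists_smul_eq_mk_rep K v hv
  exact ⟨a, a.ne_zero, ha⟩

/-- Dividing by the `j`-th coordinate cancels the arbitrary scalar in the choice of `rep`. -/
theorem normalizedRep_mk {ι : Type*} (j : ι) {v : ι → K} (hv : v ≠ 0) :
    normalizedRep j (Projectivization.mk K v hv) = (v j)⁻¹ • v := by
  obtain ⟨c, hc, h⟩ := Projectivization.exists_rep_smul (K := K) hv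
  rw [normalizedRep, ← h, Pi.smul_apply, smul_smul, smul_eq_mul, mul_inv, mul_right_comm,
    inv_mul_cancel₀ hc, one_mul]

theorem mk_mem_affineChart {ι : Type*} {j : ι} {v : ι → K} {hv : v ≠ 0} :
    Projectivization.mk K v hv ∈ affineChart K j ↔ v j ≠ 0 := by
  obtain ⟨c, hc, h⟩ := Projectivization.exists_rep_smul (K := K) hv
  change (Projectivization.mk K v hv).rep j ≠ 0 ↔ _
  rw [← h, Pi.smul_apply, smul_eq_mul]
  simp [hc]

theorem isOpen_preimage_mk' {p : E → K} (hp : p ∈ polyFun K E) {D : Set (ℙ K E)}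
    (h : ∀ v (hv : v ≠ 0), Projectivization.mk K v hv ∈ D ↔ p v ≠ 0) :
    IsOpen[(projSpace K E).top] D :=
  ⟨_, isOpen_ne_zero hp, Set.ext fun v => (h v.1 v.2).symm⟩

theorem isOpen_affineChart {ι : Type*} (j : ι) :
    IsOpen[(projSpace K (ι → K)).top] (affineChart K j) :=
  isOpen_preimage_mk' (polyFun_dual (LinearMap.proj j)) fun _ _ => mk_mem_affineChart

theorem exists_mem_affineChart {ι : Type*} (x : ℙ K (ι → K)) : ∃ j, x ∈ affineChart K j :=
  Function.ne_iff.1 x.rep_nonzero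

/-- A regular section of the quotient map over the chart. It serves to lift points of projective
space to vectors, which `rep` itself does not do regularly. -/
theorem isMor_normalizedRep {ι : Type*} (j : ι) :
    IsMor ((projSpace K (ι → K)).induced (Subtype.val : affineChart K j → _))
      (affineSpace K (ι → K)) fun x => normalizedRep j x.1 := by
  refine .of_comp_coinduced_restrict (affineSpace_isLocal.induced _) (isOpen_affineChart j) ?_
  refine .of_induced_comp affineSpace_isLocal (isMor_of_rational fun l => ?_)
  refine ⟨_, polyFun_dual l, _, polyFun_dual (LinearMap.proj j),
    fun x => ⟨(mk_mem_affineChart (hv := x.1.2)).1 x.2, ?_⟩⟩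
  change l (normalizedRep j (Projectivization.mk K x.1.1 x.1.2)) = _
  rw [normalizedRep_mk, map_smul, smul_eq_mul, div_eq_inv_mul]
  rfl

end Proj

/-! ### Left orthogonal subcategories -/

namespace QRep

variable {K : Type u} [Field K] {Q : Type} [Quiver.{0} Q]

/-- Composition of morphisms. -/
def Hom.comp {M N L : QRep K Q} (ψ : Hom N L) (φ : Hom M N) : Hom M L where
  app i := ψ.app i ∘ₗ φ.app i
  comm a x := by simp [φ.comm, ψ.comm]

/-- The inclusion of the first summand. -/
def Hom.inl (M N : QRep K Q) : Hom M (M.sum N) where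
  app _ := LinearMap.inl K _ _
  comm a x := by
    change (M.map a x, 0) = (M.map a x, N.map a 0)
    rw [map_zero]

/-- The inclusion of the second summand. -/
def Hom.inr (M N : QRep K Q) : Hom N (M.sum N) where
  app _ := LinearMap.inr K _ _
  comm a x := by
    change (0, N.map a x) = (M.map a 0, N.map a x)
    rw [map_zero]

/-- The projection to the first summand. -/
def Hom.fst (M N : QRep K Q) : Hom (M.sum N) M where
  app _ := LinearMap.fst K _ _
  comm _ _ := rfl

/-- The projection to the second summand. -/
def Hom.snd (M N : QRep K Q) : Hom (M.sum N) N where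
  app _ := LinearMap.snd K _ _
  comm _ _ := rfl

/-- The projection to a quotient. -/
def Sub.mkQ {M : QRep K Q} (U : M.Sub) : Hom M U.quot where
  app i := (U.carrier i).mkQ
  comm _ _ := rfl

/-- Precomposition with an epimorphism is injective on morphisms to `W`. This covers isomorphisms,
direct summands and quotients at once. -/
theorem leftPerp_of_surjective {W M N : QRep K Q} (φ : Hom M N)
    (hφ : ∀ i, Function.Surjective (φ.app i)) (hM : leftPerp W M) : leftPerp W N := by
  intro ψ i
  ext y
  obtain ⟨x, rfl⟩ := hφ i y
  exact LinearMap.congr_fun (hM (ψ.comp φ) i) x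

theorem leftPerp_sum_iff {W M N : QRep K Q} :
    leftPerp W (M.sum N) ↔ leftPerp W M ∧ leftPerp W N := by
  refine ⟨fun h => ⟨leftPerp_of_surjective (.fst M N) (fun _ x => ⟨(x, 0), rfl⟩) h,
    leftPerp_of_surjective (.snd M N) (fun _ x => ⟨(0, x), rfl⟩) h⟩, fun h ψ i => ?_⟩
  refine LinearMap.ext fun x => ?_
  have h1 : ψ.app i (x.1, 0) = 0 := LinearMap.congr_fun (h.1 (ψ.comp (.inl M N)) i) x.1
  have h2 : ψ.app i (0, x.2) = 0 := LinearMap.congr_fun (h.2 (ψ.comp (.inr M N)) i) x.2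
  have h3 : x = ((x.1, 0) : M.obj i × N.obj i) + ((0, x.2) : M.obj i × N.obj i) := by
    rw [Prod.mk_add_mk, add_zero, zero_add]
    rfl
  rw [h3]
  exact (map_add (ψ.app i) _ _).trans (by rw [h1, h2, add_zero]; rfl)

theorem leftPerp_extension {W A B C : QRep K Q} (f : Hom A B) (g : Hom B C)
    (hg : ∀ i, Function.Surjective (g.app i))
    (hfg : ∀ i, LinearMap.range (f.app i) = LinearMap.ker (g.app i)) (hA : leftPerp W A)
    (hC : leftPerp W C) : leftPerp W B := by
  intro φ
  choose s hs using fun i =>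
    (g.app i).exists_rightInverse_of_surjective (LinearMap.range_eq_top.2 (hg i))
  -- Since `φ` vanishes on the image of `A`, it factors through `C`. The sections `s` are only
  -- linear at each vertex, but `φ ∘ s` does not depend on their choice and is therefore a morphism.
  have key : ∀ i x, φ.app i (s i (g.app i x)) = φ.app i x := by
    intro i x
    have hx : s i (g.app i x) - x ∈ LinearMap.ker (g.app i) := by
      rw [LinearMap.mem_ker, map_sub, sub_eq_zero]
      exact LinearMap.congr_fun (hs i) _
    rw [← hfg] at hx
    obtain ⟨y, hy⟩ := hx
    rw [← sub_eq_zero, ← map_sub, ← hy]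
    exact LinearMap.congr_fun (hA (φ.comp f) i) y
  let ψ : Hom C W :=
    { app := fun i => φ.app i ∘ₗ s i
      comm := by
        intro i j a y
        obtain ⟨x, rfl⟩ := hg i y
        rw [LinearMap.comp_apply, LinearMap.comp_apply, ← g.comm, key, key, φ.comm] }
  intro i
  ext x
  rw [← key]
  exact LinearMap.congr_fun (hC ψ i) (g.app i x)

/-- The map whose kernel consists of the morphisms from the representation given by a point of the
representation space. -/
def homDefect (W : QRep K Q) {d : Q → ℕ} (M : Space K Q d) :
    (∀ i, (Fin (d i) → K) →ₗ[K] W.obj i) →ₗ[K]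
      (∀ i j : Q, (i ⟶ j) → ((Fin (d i) → K) →ₗ[K] W.obj j)) where
  toFun φ i j a := φ j ∘ₗ M i j a - W.map a ∘ₗ φ i
  map_add' φ ψ := by
    funext i j a
    ext x
    simp
    abel
  map_smul' c φ := by
    funext i j a
    ext x
    simp [smul_sub]

theorem leftPerp_ofSpace_iff (W : QRep K Q) {d : Q → ℕ} (M : Space K Q d) :
    leftPerp W (ofSpace M) ↔ Function.Injective (homDefect W M) := by
  rw [← LinearMap.ker_eq_bot, LinearMap.ker_eq_bot']
  constructor
  · intro h φ hφ
    funext i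
    refine h ⟨φ, fun {i j} a x => ?_⟩ i
    exact sub_eq_zero.1 (LinearMap.congr_fun (congrFun (congrFun (congrFun hφ i) j) a) x)
  · intro h φ i
    refine congrFun (h φ.app ?_) i
    funext i j a
    refine LinearMap.ext fun x => ?_
    exact sub_eq_zero.2 (φ.comm a x)

theorem isOpen_leftPerp [Finite Q] (W : QRep K Q) (d : Q → ℕ) :
    IsOpen[(affineSpace K (Space K Q d)).top] {M | leftPerp W (ofSpace M)} := by
  simp only [leftPerp_ofSpace_iff]
  refine isOpen_injective _ fun φ l => ?_
  let L : Space K Q d →ₗ[K] (∀ i j : Q, (i ⟶ j) → ((Fin (d i) → K) →ₗ[K] W.obj j)) :=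
    { toFun := fun M i j a => φ j ∘ₗ M i j a
      map_add' := fun M N => by
        funext i j a
        exact LinearMap.comp_add _ _ _
      map_smul' := fun c M => by
        funext i j a
        exact LinearMap.comp_smul _ _ _ }
  -- The defect is affine in `M`: a linear part, plus the constant contributed by the arrows of `W`.
  have : (fun M => l (homDefect W M φ)) =
      (fun M => (l ∘ₗ L) M) + algebraMap K _ (l (homDefect W (0 : Space K Q d) φ)) := by
    funext M
    simp only [Pi.add_apply, LinearMap.comp_apply, Pi.algebraMap_apply, Algebra.algebraMap_self,
      RingHom.id_apply]
    rw [← map_add]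
    congr 1
    funext i j a
    ext x
    simp [homDefect, L, sub_eq_add_neg]
  rw [this]
  exact add_mem (polyFun_dual _) (algebraMap_mem _ _)

theorem isOpenFullyExact_leftPerp [Finite Q] (W : QRep K Q) : IsOpenFullyExact (leftPerp W) where
  iso _ _ φ hφ := leftPerp_of_surjective φ fun i => (hφ i).2
  zero M hM φ i := by
    ext x
    have := hM i
    rw [Subsingleton.elim x 0, map_zero, map_zero]
  sum_iff _ _ := leftPerp_sum_iff
  ext _ _ _ f g _ hg hfg := leftPerp_extension f g hg hfg
  isOpen := isOpen_leftPerp W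

end QRep

/-! ### Exponents and lowering maps -/

namespace Exps

variable {n d : ℕ}

theorem ext_iff' {m p : Exps n d} : m = p ↔ ∀ i, m.1 i = p.1 i :=
  Subtype.ext_iff.trans DFunLike.ext_iff

/-- Raising the `j`-th exponent by one. -/
noncomputable def raise (hd : 0 < d) (q : Exps n (d - 1)) (j : Fin (n + 1)) : Exps n d :=
  ⟨q.1 + Finsupp.single j 1, by
    have := q.2
    simp only [Finsupp.add_apply, Finset.sum_add_distrib, this, Finsupp.single_apply]
    simp
    omega⟩

theorem raise_apply (hd : 0 < d) (q : Exps n (d - 1)) (j i : Fin (n + 1)) :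
    (raise hd q j).1 i = q.1 i + if j = i then 1 else 0 := by
  simp [raise, Finsupp.single_apply]

theorem lower_apply (m : Exps n d) (j : Fin (n + 1)) (h : 0 < m.1 j) (i : Fin (n + 1)) :
    (m.lower j h).1 i = m.1 i - if j = i then 1 else 0 := by
  simp [lower, Finsupp.single_apply]

theorem raise_lower (hd : 0 < d) (m : Exps n d) (j : Fin (n + 1)) (h : 0 < m.1 j) :
    raise hd (m.lower j h) j = m := by
  rw [ext_iff']
  intro i
  rw [raise_apply, lower_apply]
  split_ifs with hi
  · subst hi
    omega
  · rfl

theorem raise_pos (hd : 0 < d) (q : Exps n (d - 1)) (j : Fin (n + 1)) :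
    0 < (raise hd q j).1 j := by
  simp [raise_apply]

theorem lower_raise (hd : 0 < d) (q : Exps n (d - 1)) (j : Fin (n + 1)) :
    (raise hd q j).lower j (raise_pos hd q j) = q := by
  rw [ext_iff']
  intro i
  rw [lower_apply, raise_apply]
  omega

theorem raise_injective (hd : 0 < d) (j : Fin (n + 1)) :
    Function.Injective fun q : Exps n (d - 1) => raise hd q j := by
  intro q r h
  rw [ext_iff'] at h ⊢
  intro i
  have := h i
  simp only [raise_apply] at this
  omega

theorem pos_of_pos {m : Exps n d} {j : Fin (n + 1)} (h : 0 < m.1 j) : 0 < d := by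
  rw [← m.2]
  exact lt_of_lt_of_le h (Finset.single_le_sum (f := fun i => m.1 i) (fun _ _ => Nat.zero_le _)
    (Finset.mem_univ j))

theorem exists_pos (hd : 0 < d) (m : Exps n d) : ∃ j, 0 < m.1 j := by
  by_contra! h
  have := m.2
  rw [Finset.sum_eq_zero fun i _ => Nat.le_zero.1 (h i)] at this
  omega

/-- Exponents of equal total degree are equal as soon as one dominates the other. -/
theorem exists_lt {m p : Exps n d} (h : m ≠ p) : ∃ j, m.1 j < p.1 j := by
  by_contra! h'
  refine h (ext_iff'.2 fun i => ?_)
  have := (Finset.sum_eq_sum_iff_of_le fun i _ => h' i).1 (p.2.trans m.2.symm)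
  exact (this i (Finset.mem_univ i)).symm

/-- Replacing a factor `T_i` of a monomial by `T_j`. -/
noncomputable def move (m : Exps n d) (i j : Fin (n + 1)) (h : 0 < m.1 i) : Exps n d :=
  raise (pos_of_pos h) (m.lower i h) j

theorem move_apply (m : Exps n d) (i j : Fin (n + 1)) (h : 0 < m.1 i) (l : Fin (n + 1)) :
    (m.move i j h).1 l = m.1 l - (if i = l then 1 else 0) + if j = l then 1 else 0 := by
  rw [move, raise_apply, lower_apply]

theorem raise_move (hd : 0 < d) (q : Exps n (d - 1)) (i j : Fin (n + 1)) (h : 0 < q.1 i) :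
    raise hd (q.move i j h) i = raise hd q j := by
  rw [ext_iff']
  intro l
  simp only [raise_apply, move_apply]
  split_ifs with h1 h2 h2
  · subst h1
    omega
  · subst h1
    omega
  · omega
  · omega

/-- The exponent of a power of a single variable. -/
noncomputable def power (n d : ℕ) (j : Fin (n + 1)) : Exps n d :=
  ⟨Finsupp.single j d, by simp [Finsupp.single_apply]⟩

theorem power_apply (j i : Fin (n + 1)) : (power n d j).1 i = if j = i then d else 0 := by
  simp [power, Finsupp.single_apply]

/-- Every monomial is reached from a power of a given variable by replacing factors. -/
theorem induction_move (j : Fin (n + 1)) {P : Exps n d → Prop} (h0 : P (power n d j))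
    (h : ∀ (m : Exps n d) (i : Fin (n + 1)) (hi : 0 < m.1 i), i ≠ j → P (m.move i j hi) → P m)
    (m : Exps n d) : P m := by
  induction hr : d - m.1 j using Nat.strong_induction_on generalizing m with
  | _ r ih =>
    by_cases hm : m = power n d j
    · rwa [hm]
    -- Away from the power of `T_j` there is a factor `T_i` with `i ≠ j`, and `m j < d`. Moving that
    -- factor to `j` strictly decreases `d - m j`.
    obtain ⟨i, hi⟩ := exists_lt (Ne.symm hm)
    have hle : m.1 j ≤ d := by
      have := Finset.single_le_sum (f := fun i => m.1 i) (fun _ _ => Nat.zero_le _)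
        (Finset.mem_univ j)
      rwa [m.2] at this
    have hij : i ≠ j := by
      rintro rfl
      rw [power_apply, if_pos rfl] at hi
      omega
    rw [power_apply, if_neg hij.symm] at hi
    obtain ⟨l, hl⟩ := exists_lt hm
    have hlj : l = j := by
      by_contra hlj
      rw [power_apply, if_neg (Ne.symm hlj)] at hl
      omega
    subst hlj
    rw [power_apply, if_pos rfl] at hl
    refine h m i hi hij (ih _ ?_ _ rfl)
    rw [move_apply, if_neg hij, if_pos rfl]
    omega

end Exps

section Lowering

open Exps

variable {K : Type u} [Field K] {n d : ℕ}

theorem lowerMap_single (j : Fin (n + 1)) (m : Exps n d) :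
    lowerMap K n d j (Pi.single m 1) =
      if h : 0 < m.1 j then Pi.single (m.lower j h) 1 else 0 := by
  rw [← Pi.basisFun_apply, lowerMap, Module.Basis.constr_basis]

/-- The transposed description of the lowering map: each coordinate of the image is a single
coordinate of the argument. Comparisons of coefficients below rest on it. -/
theorem lowerMap_apply (hd : 0 < d) (j : Fin (n + 1)) (v : Exps n d → K) (q : Exps n (d - 1)) :
    lowerMap K n d j v q = v (raise hd q j) := by
  have : LinearMap.proj q ∘ₗ lowerMap K n d j =
      (LinearMap.proj (raise hd q j) : (Exps n d → K) →ₗ[K] K) := by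
    refine (Pi.basisFun K (Exps n d)).ext fun m => ?_
    rw [Pi.basisFun_apply, LinearMap.comp_apply, lowerMap_single, LinearMap.proj_apply,
      LinearMap.proj_apply]
    split_ifs with h
    · by_cases hq : m = raise hd q j
      · subst hq
        rw [lower_raise, Pi.single_eq_same, Pi.single_eq_same]
      · rw [Pi.single_eq_of_ne (Ne.symm hq), Pi.single_eq_of_ne]
        rintro rfl
        exact hq (raise_lower hd m j h).symm
    · rw [Pi.single_eq_of_ne, Pi.zero_apply]
      rintro rfl
      exact h (raise_pos hd q j)
  exact LinearMap.congr_fun this v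

theorem monomials_raise (hd : 0 < d) (x : Fin (n + 1) → K) (q : Exps n (d - 1))
    (j : Fin (n + 1)) : monomials d x (raise hd q j) = x j * monomials (d - 1) x q := by
  simp only [monomials, raise_apply, pow_add, Finset.prod_mul_distrib]
  rw [mul_comm]
  congr 1
  simp

/-- The two vectors of monomials thus span a family of lines stable under the arrows `2 → 3`, on
which these arrows act by the coordinates of `x`. -/
theorem lowerMap_monomials (hd : 0 < d) (x : Fin (n + 1) → K) (j : Fin (n + 1)) :
    lowerMap K n d j (monomials d x) = x j • monomials (d - 1) x := by
  funext q
  rw [lowerMap_apply hd, monomials_raise, Pi.smul_apply, smul_eq_mul]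

theorem monomials_smul (c : K) (x : Fin (n + 1) → K) :
    monomials d (c • x) = c ^ d • monomials d x := by
  funext m
  simp only [monomials, Pi.smul_apply, smul_eq_mul, mul_pow, Finset.prod_mul_distrib,
    Finset.prod_pow_eq_pow_sum, m.2]

theorem monomials_power (x : Fin (n + 1) → K) (j : Fin (n + 1)) :
    monomials d x (power n d j) = x j ^ d := by
  simp only [monomials, power_apply]
  rw [Finset.prod_eq_single j] <;> simp +contextual [eq_comm]

/-- The vectors that the lowering maps send to multiples of a single vector are the multiples of
vectors of monomials. -/
theorem eq_smul_monomials (hd : 0 < d) {x : Fin (n + 1) → K} (hx : x ≠ 0) {v : Exps n d → K}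
    {w : Exps n (d - 1) → K} (h : ∀ j, lowerMap K n d j v = x j • w) :
    ∃ c : K, v = c • monomials d x ∧ w = c • monomials (d - 1) x := by
  have h' : ∀ j q, v (raise hd q j) = x j * w q := fun j q => by
    rw [← lowerMap_apply hd j v, h, Pi.smul_apply, smul_eq_mul]
  obtain ⟨j, hj⟩ := Function.ne_iff.1 hx
  -- Reading one coordinate of `v` in two ways gives `x j * w q = x i * w (q - e_i + e_j)`. As `x j
  -- ≠ 0`, all of `w` is determined by its value at the power of `T_j`.
  have hw : ∀ q, w q = w (power n (d - 1) j) / x j ^ (d - 1) * monomials (d - 1) x q := by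
    refine induction_move j ?_ fun q i hi hij ih => ?_
    · rw [monomials_power, div_mul_cancel₀ _ (pow_ne_zero _ hj)]
    · apply mul_left_cancel₀ hj
      rw [← h' j q, ← raise_move hd q i j hi, h', ih, mul_left_comm, mul_left_comm (x j)]
      congr 1
      rw [← monomials_raise hd, raise_move, monomials_raise]
  refine ⟨_, ?_, funext hw⟩
  funext m
  obtain ⟨i, hi⟩ := exists_pos hd m
  rw [← raise_lower hd m i hi, h', hw, Pi.smul_apply, smul_eq_mul, monomials_raise]
  ring

theorem eq_smul_of_monomials_eq_smul (hd : 0 < d) {x y : Fin (n + 1) → K} (hx : x ≠ 0) {c : K}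
    (h : monomials d x = c • monomials d y) : ∃ b : K, x = b • y := by
  obtain ⟨j, hj⟩ := Function.ne_iff.1 hx
  -- Comparison of the coordinates at `T_j ^ (d - 1) * T_i` gives this ratio, which is the same for
  -- all `i`.
  refine ⟨c * y j ^ (d - 1) / x j ^ (d - 1), funext fun i => ?_⟩
  have := congrFun h (raise hd (power n (d - 1) j) i)
  rw [Pi.smul_apply, smul_eq_mul, monomials_raise, monomials_raise, monomials_power,
    monomials_power] at this
  rw [Pi.smul_apply, smul_eq_mul, div_mul_eq_mul_div, eq_div_iff (pow_ne_zero _ hj), this]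
  ring

/-- The lowering maps have only scalar endomorphisms. -/
theorem eq_smul_of_comm_lowerMap (hd : 0 < d) (α : (Exps n d → K) →ₗ[K] (Exps n d → K))
    (β : (Exps n (d - 1) → K) →ₗ[K] (Exps n (d - 1) → K))
    (h : ∀ j v, β (lowerMap K n d j v) = lowerMap K n d j (α v)) :
    ∃ c : K, (∀ v, α v = c • v) ∧ ∀ w, β w = c • w := by
  -- In terms of matrix entries, an entry of `β` equals the entry of `α` with both indices raised at
  -- any `j`. Hence entries of `α` do not change when the same move is applied to row and column.
  have hβ : ∀ j q r, β (Pi.single q 1) r = α (Pi.single (raise hd q j) 1) (raise hd r j) := by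
    intro j q r
    rw [← lowerMap_apply hd j (α _), ← h, lowerMap_single, dif_pos (raise_pos hd q j), lower_raise]
  have hmove : ∀ m p i j (hm : 0 < m.1 i) (hp : 0 < p.1 i),
      α (Pi.single m 1) p = α (Pi.single (m.move i j hm) 1) (p.move i j hp) := by
    intro m p i j hm hp
    rw [move, move, ← hβ, hβ i, raise_lower, raise_lower]
  have hzero : ∀ m p j, m.1 j = 0 → 0 < p.1 j → α (Pi.single m 1) p = 0 := by
    intro m p j hm hp
    rw [← raise_lower hd p j hp, ← lowerMap_apply hd j (α _), ← h, lowerMap_single,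
      dif_neg (by omega), map_zero, Pi.zero_apply]
  have hlt : ∀ r j m p, m.1 j = r → m.1 j < p.1 j → α (Pi.single m 1) p = 0 := by
    intro r j
    induction r with
    | zero => exact fun m p hm hmp => hzero m p j hm (by omega)
    | succ r ih =>
      intro m p hm hmp
      -- Moving a factor from `j` to some `i ≠ j` in both indices keeps the inequality at `j` and
      -- lowers `m j`, until it is zero and lowering at `j` kills the basis vector. Equality of
      -- degrees supplies such an `i`.
      obtain ⟨i, hi⟩ := exists_lt (m := p) (p := m) (by rintro rfl; omega)
      have hij : i ≠ j := by
        rintro rfl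
        omega
      rw [hmove m p j i (by omega) (by omega)]
      refine ih _ _ ?_ ?_ <;> simp only [move_apply, if_neg hij, if_true] <;> omega
  have hoff : ∀ m p, m ≠ p → α (Pi.single m 1) p = 0 := by
    intro m p hmp
    obtain ⟨j, hj⟩ := exists_lt hmp
    exact hlt _ j m p rfl hj
  have hdiag : ∀ m, α (Pi.single m 1) m =
      α (Pi.single (power n d 0) 1) (power n d 0) :=
    induction_move 0 rfl fun m i hi _ ih => by rw [hmove m m i 0 hi hi, ih]
  refine ⟨α (Pi.single (power n d 0) 1) (power n d 0), fun v => ?_, fun w => ?_⟩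
  · have : α = α (Pi.single (power n d 0) 1) (power n d 0) • LinearMap.id := by
      refine (Pi.basisFun K (Exps n d)).ext fun m => ?_
      funext p
      rw [Pi.basisFun_apply, LinearMap.smul_apply, LinearMap.id_apply, Pi.smul_apply, smul_eq_mul]
      by_cases hmp : m = p
      · subst hmp
        rw [hdiag, Pi.single_eq_same, mul_one]
      · rw [hoff m p hmp, Pi.single_eq_of_ne (Ne.symm hmp), mul_zero]
    exact LinearMap.congr_fun this v
  · have : β = α (Pi.single (power n d 0) 1) (power n d 0) • LinearMap.id := by
      refine (Pi.basisFun K (Exps n (d - 1))).ext fun m => ?_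
      funext p
      rw [Pi.basisFun_apply, LinearMap.smul_apply, LinearMap.id_apply, Pi.smul_apply, smul_eq_mul,
        hβ 0]
      by_cases hmp : m = p
      · subst hmp
        rw [hdiag, Pi.single_eq_same, mul_one]
      · rw [hoff _ _ fun h0 => hmp (raise_injective hd 0 h0), Pi.single_eq_of_ne (Ne.symm hmp),
          mul_zero]
    exact LinearMap.congr_fun this w

theorem coeffForm_apply (f : MvPolynomial (Fin (n + 1)) K) (v : Exps n d → K) :
    coeffForm n d f v = ∑ m, v m * MvPolynomial.coeff m.1 f := by
  rw [coeffForm, Module.Basis.constr_apply_fintype]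
  simp

theorem coeffForm_single (f : MvPolynomial (Fin (n + 1)) K) (m : Exps n d) :
    coeffForm n d f (Pi.single m 1) = MvPolynomial.coeff m.1 f := by
  rw [← Pi.basisFun_apply, coeffForm, Module.Basis.constr_basis]

theorem sum_eq_of_coeff_ne_zero {f : MvPolynomial (Fin (n + 1)) K} (hf : f.IsHomogeneous d)
    {m : Fin (n + 1) →₀ ℕ} (hm : MvPolynomial.coeff m f ≠ 0) : ∑ i, m i = d := by
  by_contra h
  refine hm (hf.coeff_eq_zero ?_)
  rwa [Finsupp.degree_eq_sum]

theorem coeffForm_monomials {f : MvPolynomial (Fin (n + 1)) K} (hf : f.IsHomogeneous d)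
    (x : Fin (n + 1) → K) : coeffForm n d f (monomials d x) = MvPolynomial.eval x f := by
  rw [coeffForm_apply, MvPolynomial.eval_eq']
  have hs : ∀ m : Fin (n + 1) →₀ ℕ, m ∈ Finset.finsuppAntidiag Finset.univ d ↔ ∑ i, m i = d := by
    simp [Finset.mem_finsuppAntidiag]
  rw [Finset.sum_subset (s₂ := Finset.finsuppAntidiag Finset.univ d)]
  · rw [Finset.sum_subtype _ hs]
    exact Fintype.sum_congr _ _ fun m => mul_comm _ _
  · exact fun m hm => (hs m).2 (sum_eq_of_coeff_ne_zero hf (MvPolynomial.mem_support_iff.1 hm))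
  · intro m _ hm
    rw [MvPolynomial.notMem_support_iff.1 hm, zero_mul]

theorem eval_smul_of_isHomogeneous {f : MvPolynomial (Fin (n + 1)) K} (hf : f.IsHomogeneous d)
    (c : K) (x : Fin (n + 1) → K) :
    MvPolynomial.eval (c • x) f = c ^ d * MvPolynomial.eval x f := by
  rw [← coeffForm_monomials hf, monomials_smul, map_smul, coeffForm_monomials hf, smul_eq_mul]

end Lowering

/-! ### The representations attached to equations -/

section EqnRep

variable {K : Type u} [Field K] {n k d : ℕ} {f h : Fin k → MvPolynomial (Fin (n + 1)) K}

/-- The arrow `2 → 3` with the given index. -/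
def Vert.arrowThree {n k : ℕ} (j : Fin (n + 1)) : (Vert.two : Vert n k) ⟶ Vert.three := j

/-- The arrow `2 → 1` with the given index. -/
def Vert.arrowOne {n k : ℕ} (i : Fin k) : (Vert.two : Vert n k) ⟶ Vert.one := i

/-- The arrows `2 → 3` force one common scalar at vertices 2 and 3, and vertex 1 is one-dimensional.
The arrows `2 → 1`, evaluated on basis vectors, then compare `f` and `h` coefficient by coefficient.
-/
theorem eqnRep_hom (hd : 0 < d) (hf : ∀ i, (f i).IsHomogeneous d) (hh : ∀ i, (h i).IsHomogeneous d)
    (φ : QRep.Hom (eqnRep d f) (eqnRep d h)) :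
    ∃ c μ : K, (∀ v, φ.app .one v = μ • v) ∧ (∀ v, φ.app .two v = c • v) ∧
      (∀ v, φ.app .three v = c • v) ∧ μ • f = c • h := by
  obtain ⟨c, h2, h3⟩ := eq_smul_of_comm_lowerMap hd (φ.app .two) (φ.app .three)
    fun j v => φ.comm (Vert.arrowThree j) v
  let φ1 : (Unit → K) →ₗ[K] (Unit → K) := φ.app .one
  have h1 : ∀ v, φ1 v = φ1 (fun _ => 1) () • v := by
    intro v
    have hv : v = v () • fun _ => (1 : K) := by
      funext
      simp
    funext
    conv_lhs => rw [hv, map_smul]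
    simp [mul_comm]
  refine ⟨c, φ1 (fun _ => 1) (), h1, h2, h3, ?_⟩
  funext a
  rw [Pi.smul_apply, Pi.smul_apply]
  ext m
  rw [MvPolynomial.coeff_smul, MvPolynomial.coeff_smul]
  by_cases hm : ∑ i, m i = d
  · let e : Exps n d → K := Pi.single ⟨m, hm⟩ 1
    have h4 : φ1 (fun _ => coeffForm n d (f a) e) () = coeffForm n d (h a) (c • e) :=
      (congrFun (φ.comm (Vert.arrowOne a) e) ()).trans (congrArg (coeffForm n d (h a)) (h2 e))
    have he : ∀ g, coeffForm n d g e = MvPolynomial.coeff m g := fun g => coeffForm_single g _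
    rwa [h1, map_smul, Pi.smul_apply, he, he] at h4
  · rw [not_imp_comm.1 (sum_eq_of_coeff_ne_zero (hf a)) hm,
      not_imp_comm.1 (sum_eq_of_coeff_ne_zero (hh a)) hm, smul_zero, smul_zero]

theorem eqnRep_isBrick (hd : 0 < d) (hf : ∀ i, (f i).IsHomogeneous d) (hf0 : f ≠ 0) :
    (eqnRep d f).IsBrick := by
  refine ⟨⟨.one, inferInstanceAs (Nontrivial (Unit → K))⟩, ?_⟩
  rintro φ ⟨i, hi⟩
  obtain ⟨c, μ, h1, h2, h3, h4⟩ := eqnRep_hom hd hf hf φ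
  obtain rfl : μ = c := smul_left_injective K hf0 h4
  have hφ : ∀ i v, φ.app i v = μ • v := by
    rintro (_ | _ | _)
    exacts [h1, h2, h3]
  have hμ : μ ≠ 0 := by
    rintro rfl
    refine hi (LinearMap.ext fun v => ?_)
    rw [hφ, zero_smul, LinearMap.zero_apply]
  intro i
  refine ⟨fun v w hvw => ?_, fun v => ⟨μ⁻¹ • v, ?_⟩⟩
  · rw [hφ, hφ] at hvw
    exact smul_right_injective _ hμ hvw
  · rw [hφ, smul_inv_smul₀ hμ]

/-- In `μ • f = c • h`, a nonzero `c` would make `h` a multiple of `f`. So `c = 0`, and then `μ = 0`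
because `f ≠ 0`. -/
theorem eqnRep_homZero (hd : 0 < d) (hf : ∀ i, (f i).IsHomogeneous d)
    (hh : ∀ i, (h i).IsHomogeneous d) (hf0 : f ≠ 0) (hfh : ∀ c : K, h ≠ c • f) :
    QRep.HomZero (eqnRep d f) (eqnRep d h) := by
  intro φ
  obtain ⟨c, μ, h1, h2, h3, h4⟩ := eqnRep_hom hd hf hh φ
  have hc : c = 0 := by
    by_contra hc
    refine hfh (c⁻¹ * μ) ?_
    rw [mul_smul, h4, inv_smul_smul₀ hc]
  subst hc
  have hμ : μ = 0 := by
    rw [zero_smul] at h4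
    exact (smul_eq_zero.1 h4).resolve_right hf0
  subst hμ
  rintro (_ | _ | _)
  exacts [LinearMap.ext fun v => (h1 v).trans (zero_smul K v),
    LinearMap.ext fun v => (h2 v).trans (zero_smul K v),
    LinearMap.ext fun v => (h3 v).trans (zero_smul K v)]

theorem eqnRep_homZero_symm (hd : 0 < d) (hf : ∀ i, (f i).IsHomogeneous d)
    (hh : ∀ i, (h i).IsHomogeneous d) (hf0 : f ≠ 0) (hfh : ∀ c : K, h ≠ c • f) :
    QRep.HomZero (eqnRep d h) (eqnRep d f) := by
  have hh0 : h ≠ 0 := by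
    rw [← zero_smul K f]
    exact hfh 0
  refine eqnRep_homZero hd hh hf hh0 fun c hc => ?_
  have hc0 : c ≠ 0 := by
    rintro rfl
    rw [zero_smul] at hc
    exact hf0 hc
  exact hfh c⁻¹ (by rw [hc, inv_smul_smul₀ hc0])

instance Vert.instFinite (n k : ℕ) : Finite (Vert n k) :=
  Finite.of_injective (fun v => match v with | .one => (0 : Fin 3) | .two => 1 | .three => 2)
    (by rintro (_ | _ | _) (_ | _ | _) <;> simp)

end EqnRep

/-! ### Quiver Grassmannians and Reineke's isomorphism -/

open FunSpace

namespace QRep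

variable {K : Type u} [Field K] {Q : Type} [Quiver.{0} Q]

theorem grSpace_isLocal (e : Q → ℕ) (M : QRep K Q) : (grSpace e M).IsLocal :=
  (affineSpace_isLocal.induced _).coinduced _

theorem Gr.ext_carrier {e : Q → ℕ} {M : QRep K Q} {U U' : Gr e M}
    (h : ∀ i, U.1.carrier i = U'.1.carrier i) : U = U' := by
  obtain ⟨⟨c, _⟩, _⟩ := U
  obtain ⟨⟨c', _⟩, _⟩ := U'
  obtain rfl : c = c' := funext h
  rfl

theorem Infl.toGr_surjective (e : Q → ℕ) (M : QRep K Q) :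
    Function.Surjective (Infl.toGr : Infl e M → Gr e M) := by
  intro U
  have hb : ∀ i, Nonempty ((Fin (e i) → K) ≃ₗ[K] U.1.carrier i) := fun i =>
    ⟨(Module.finBasisOfFinrankEq K _ (U.2 i)).equivFun.symm⟩
  let b := fun i => (hb i).some
  refine ⟨⟨⟨fun i j a => (b j).symm.toLinearMap ∘ₗ (M.map a).restrict (U.1.stable a) ∘ₗ
    (b i).toLinearMap, fun i => (U.1.carrier i).subtype ∘ₗ (b i).toLinearMap⟩, ?_, ?_⟩, ?_⟩
  · exact fun i => Subtype.val_injective.comp (b i).injective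
  · intro i j a x
    simp
  · refine Gr.ext_carrier fun i => ?_
    change LinearMap.range ((U.1.carrier i).subtype ∘ₗ (b i).toLinearMap) = _
    rw [LinearMap.range_comp, LinearEquiv.range, Submodule.map_top, Submodule.range_subtype]

end QRep

section Reineke

variable {K : Type u} [Field K] {n k d : ℕ} {f h : Fin k → MvPolynomial (Fin (n + 1)) K}

/-- The points of the representation space of dimension vector `(0, 1, 1)`, in terms of the scalars
attached to the arrows `2 → 3`. -/
noncomputable def arrowSpace (K : Type u) [Field K] (n k : ℕ) :
    (Fin (n + 1) → K) →ₗ[K] QRep.Space K (Vert n k) dimVec :=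
  LinearMap.pi fun i => LinearMap.pi fun j => LinearMap.pi fun a =>
    match i, j, a with
    | .two, .three, (a : Fin (n + 1)) =>
      (LinearMap.proj a : (Fin (n + 1) → K) →ₗ[K] K).smulRight LinearMap.id
    | .two, .one, _ => 0
    | .one, _, a => nomatch a
    | .three, _, a => nomatch a
    | .two, .two, a => nomatch a

/-- The families of linear maps from the spaces `0, K, K` to those of the representation attached to
equations, in terms of the images of the basis vectors. -/
noncomputable def embSpace (d : ℕ) (f : Fin k → MvPolynomial (Fin (n + 1)) K) :
    ((Exps n d → K) × (Exps n (d - 1) → K)) →ₗ[K]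
      (∀ i : Vert n k, (Fin (dimVec i) → K) →ₗ[K] (eqnRep d f).obj i) :=
  LinearMap.pi fun i =>
    match i with
    | .one => 0
    | .two => (LinearMap.smulRightₗ (LinearMap.proj (0 : Fin 1) : (Fin 1 → K) →ₗ[K] K) :
        (Exps n d → K) →ₗ[K] (Fin 1 → K) →ₗ[K] (Exps n d → K)) ∘ₗ LinearMap.fst K _ _
    | .three => (LinearMap.smulRightₗ (LinearMap.proj (0 : Fin 1) : (Fin 1 → K) →ₗ[K] K) :
        (Exps n (d - 1) → K) →ₗ[K] (Fin 1 → K) →ₗ[K] (Exps n (d - 1) → K)) ∘ₗ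
          LinearMap.snd K _ _

theorem mem_infl {x : Fin (n + 1) → K} {v : Exps n d → K} {w : Exps n (d - 1) → K} (hv : v ≠ 0)
    (hw : w ≠ 0) (hvw : ∀ j, lowerMap K n d j v = x j • w)
    (hf : ∀ i, coeffForm n d (f i) v = 0) :
    (arrowSpace K n k x, embSpace d f (v, w)) ∈ QRep.Infl dimVec (eqnRep d f) := by
  have hinj : ∀ {F : Type u} [AddCommGroup F] [Module K F] {u : F}, u ≠ 0 →
      Function.Injective ((LinearMap.proj 0 : (Fin 1 → K) →ₗ[K] K).smulRight u) := by
    intro F _ _ u hu y z hyz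
    funext i
    rw [Subsingleton.elim i 0]
    exact smul_left_injective K hu hyz
  refine ⟨?_, ?_⟩
  · rintro (_ | _ | _)
    · exact fun y z _ => funext fun i => Fin.elim0 i
    · exact hinj hv
    · exact hinj hw
  · rintro (_ | _ | _) (_ | _ | _) a y
    · exact nomatch a
    · exact nomatch a
    · exact nomatch a
    · have key : ∀ (t : K) (i : Fin k), (fun _ : Unit => coeffForm n d (f i) (t • v)) = 0 := by
        intro t i
        funext
        rw [map_smul, hf, smul_zero, Pi.zero_apply]
      exact key (y (0 : Fin 1)) a
    · exact nomatch a
    · have key : ∀ (t : K) (j : Fin (n + 1)), lowerMap K n d j (t • v) = (x j * t) • w := by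
        intro t j
        rw [map_smul, hvw, smul_smul, mul_comm]
      exact key (y (0 : Fin 1)) a
    · exact nomatch a
    · exact nomatch a
    · exact nomatch a

/-- The inflation attached to a common zero of the equations. -/
noncomputable def monomialInfl (hd : 0 < d) (hf : ∀ i, (f i).IsHomogeneous d)
    {x : Fin (n + 1) → K} (hx : x ≠ 0)
    (hfx : ∀ i, MvPolynomial.eval x (f i) = 0) : QRep.Infl dimVec (eqnRep d f) :=
  ⟨(arrowSpace K n k x, embSpace d f (monomials d x, monomials (d - 1) x)),
    mem_infl (monomials_ne_zero d hx) (monomials_ne_zero (d - 1) hx) (lowerMap_monomials hd x)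
      fun i => by rw [coeffForm_monomials (hf i), hfx]⟩

theorem QRep.Gr.carrier_one {M : QRep K (Vert n k)} (U : QRep.Gr dimVec M) :
    U.1.carrier .one = ⊥ :=
  Submodule.finrank_eq_zero.1 (U.2 .one)

theorem QRep.Gr.ext_two_three {M : QRep K (Vert n k)} {U U' : QRep.Gr dimVec M}
    (h2 : U.1.carrier .two = U'.1.carrier .two) (h3 : U.1.carrier .three = U'.1.carrier .three) :
    U = U' := by
  refine QRep.Gr.ext_carrier ?_
  rintro (_ | _ | _)
  · rw [U.carrier_one, U'.carrier_one]
  · exact h2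
  · exact h3

theorem range_eq_span_singleton {F : Type*} [AddCommGroup F] [Module K F]
    (g : (Fin 1 → K) →ₗ[K] F) : LinearMap.range g = K ∙ g 1 := by
  have : ∀ y, g y = y 0 • g 1 := fun y => by
    rw [← map_smul]
    congr 1
    funext i
    simp [Subsingleton.elim i 0]
  ext z
  rw [Submodule.mem_span_singleton]
  constructor
  · rintro ⟨y, rfl⟩
    exact ⟨y 0, (this y).symm⟩
  · rintro ⟨a, rfl⟩
    exact ⟨a • 1, map_smul g a 1⟩

theorem monomialInfl_carrier_two (hd : 0 < d) (hf : ∀ i, (f i).IsHomogeneous d)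
    {x : Fin (n + 1) → K} (hx : x ≠ 0) (hfx : ∀ i, MvPolynomial.eval x (f i) = 0) :
    (QRep.Infl.toGr (monomialInfl hd hf hx hfx)).1.carrier .two = K ∙ monomials d x :=
  (range_eq_span_singleton _).trans (congrArg (fun v => K ∙ v) (one_smul K (monomials d x)))

theorem monomialInfl_carrier_three (hd : 0 < d) (hf : ∀ i, (f i).IsHomogeneous d)
    {x : Fin (n + 1) → K} (hx : x ≠ 0) (hfx : ∀ i, MvPolynomial.eval x (f i) = 0) :
    (QRep.Infl.toGr (monomialInfl hd hf hx hfx)).1.carrier .three = K ∙ monomials (d - 1) x :=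
  (range_eq_span_singleton _).trans (congrArg (fun v => K ∙ v) (one_smul K (monomials (d - 1) x)))

theorem span_smul_monomials {c : K} (hc : c ≠ 0) (x : Fin (n + 1) → K) :
    (K ∙ monomials d (c • x)) = K ∙ monomials d x := by
  rw [monomials_smul]
  exact Submodule.span_singleton_smul_eq (pow_ne_zero d hc).isUnit _

theorem eval_smul_eq_zero_iff {g : MvPolynomial (Fin (n + 1)) K} (hg : g.IsHomogeneous d) {c : K}
    (hc : c ≠ 0) (x : Fin (n + 1) → K) :
    MvPolynomial.eval (c • x) g = 0 ↔ MvPolynomial.eval x g = 0 := by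
  rw [eval_smul_of_isHomogeneous hg]
  simp [hc]

theorem eval_rep_mk_eq_zero_iff {g : MvPolynomial (Fin (n + 1)) K} (hg : g.IsHomogeneous d)
    {x : Fin (n + 1) → K} (hx : x ≠ 0) :
    MvPolynomial.eval (Projectivization.mk K x hx).rep g = 0 ↔ MvPolynomial.eval x g = 0 := by
  obtain ⟨c, hc, h⟩ := Projectivization.exists_rep_smul (K := K) hx
  rw [← h, eval_smul_eq_zero_iff hg hc]

theorem toGr_monomialInfl_smul (hd : 0 < d) (hf : ∀ i, (f i).IsHomogeneous d)
    {x y : Fin (n + 1) → K} (hx : x ≠ 0) (hfx : ∀ i, MvPolynomial.eval x (f i) = 0) (hy : y ≠ 0)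
    (hfy : ∀ i, MvPolynomial.eval y (f i) = 0) {c : K} (hc : c ≠ 0) (h : y = c • x) :
    QRep.Infl.toGr (monomialInfl hd hf hy hfy) = QRep.Infl.toGr (monomialInfl hd hf hx hfx) := by
  subst h
  apply QRep.Gr.ext_two_three
  · rw [monomialInfl_carrier_two, monomialInfl_carrier_two, span_smul_monomials hc]
  · rw [monomialInfl_carrier_three, monomialInfl_carrier_three, span_smul_monomials hc]

/-- The scalars attached to the arrows `2 → 3`. -/
noncomputable def arrowScalars (f : Fin k → MvPolynomial (Fin (n + 1)) K) :
    (QRep.Space K (Vert n k) dimVec ×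
      (∀ i : Vert n k, (Fin (dimVec i) → K) →ₗ[K] (eqnRep d f).obj i)) →ₗ[K] (Fin (n + 1) → K) where
  toFun p j := p.1 .two .three j (1 : Fin 1 → K) (0 : Fin 1)
  map_add' _ _ := rfl
  map_smul' _ _ := rfl

/-- The images `v`, `w` of the basis vectors satisfy the hypothesis of `eq_smul_monomials` with `x`
the scalars of the arrows. Here `x ≠ 0`, since otherwise all lowering maps would kill `v`, which for
positive degree means `v = 0`. -/
theorem arrowScalars_spec (hd : 0 < d) (hf : ∀ i, (f i).IsHomogeneous d)
    (p : QRep.Infl dimVec (eqnRep d f)) :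
    ∃ (hx : arrowScalars f p.1 ≠ 0) (hfx : ∀ i, MvPolynomial.eval (arrowScalars f p.1) (f i) = 0),
      QRep.Infl.toGr p = QRep.Infl.toGr (monomialInfl hd hf hx hfx) := by
  obtain ⟨⟨M, ι⟩, hinj, hcomm⟩ := p
  let ι2 : (Fin 1 → K) →ₗ[K] (Exps n d → K) := ι .two
  let ι3 : (Fin 1 → K) →ₗ[K] (Exps n (d - 1) → K) := ι .three
  let x : Fin (n + 1) → K := fun j => M .two .three j (1 : Fin 1 → K) (0 : Fin 1)
  have hι2 : Function.Injective ι2 := hinj .two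
  have hv : ι2 1 ≠ 0 := fun h0 => one_ne_zero (hι2 (h0.trans (map_zero ι2).symm))
  have hone : ∀ z : Fin 1 → K, z = z 0 • 1 := fun z => by
    funext i
    simp [Subsingleton.elim i 0]
  have hvw : ∀ j, lowerMap K n d j (ι2 1) = x j • ι3 1 := by
    intro j
    exact (hcomm .two .three j (1 : Fin 1 → K)).trans
      ((congrArg ι3 (hone _)).trans (map_smul ι3 _ _))
  have hfv : ∀ i, coeffForm n d (f i) (ι2 1) = 0 := by
    intro i
    have h1 := hcomm .two .one i (1 : Fin 1 → K)
    have h2 : M .two .one i (1 : Fin 1 → K) = 0 := funext fun i => Fin.elim0 i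
    rw [h2, map_zero] at h1
    exact congrFun h1 ()
  have hx : x ≠ 0 := by
    intro hx
    refine hv (funext fun m => ?_)
    obtain ⟨j, hj⟩ := Exps.exists_pos hd m
    rw [← Exps.raise_lower hd m j hj, ← lowerMap_apply hd j (ι2 1), hvw, hx, Pi.zero_apply,
      zero_smul]
    rfl
  obtain ⟨c, hc2, hc3⟩ := eq_smul_monomials hd hx hvw
  have hc : c ≠ 0 := by
    rintro rfl
    exact hv (hc2.trans (zero_smul K _))
  have hfx : ∀ i, MvPolynomial.eval x (f i) = 0 := fun i => by
    have := hfv i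
    rw [hc2, map_smul, coeffForm_monomials (hf i)] at this
    exact (smul_eq_zero.1 this).resolve_left hc
  refine ⟨hx, hfx, QRep.Gr.ext_two_three ?_ ?_⟩
  · refine Eq.trans ?_ (monomialInfl_carrier_two hd hf hx hfx).symm
    refine (range_eq_span_singleton ι2).trans ?_
    rw [hc2]
    exact Submodule.span_singleton_smul_eq hc.isUnit _
  · refine Eq.trans ?_ (monomialInfl_carrier_three hd hf hx hfx).symm
    refine (range_eq_span_singleton ι3).trans ?_
    rw [hc3]
    exact Submodule.span_singleton_smul_eq hc.isUnit _

/-- The subrepresentation attached to a point of the projective variety. -/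
noncomputable def pointGr (hd : 0 < d) (hf : ∀ i, (f i).IsHomogeneous d) (x : projVariety f) :
    QRep.Gr dimVec (eqnRep d f) :=
  QRep.Infl.toGr (monomialInfl hd hf x.1.rep_nonzero x.2)

theorem mk_mem_projVariety (hf : ∀ i, (f i).IsHomogeneous d) {x : Fin (n + 1) → K} (hx : x ≠ 0)
    (hfx : ∀ i, MvPolynomial.eval x (f i) = 0) : Projectivization.mk K x hx ∈ projVariety f :=
  fun i => (eval_rep_mk_eq_zero_iff (hf i) hx).2 (hfx i)

theorem pointGr_mk (hd : 0 < d) (hf : ∀ i, (f i).IsHomogeneous d) {x : Fin (n + 1) → K}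
    (hx : x ≠ 0) (hfx : ∀ i, MvPolynomial.eval x (f i) = 0) :
    pointGr hd hf ⟨Projectivization.mk K x hx, mk_mem_projVariety hf hx hfx⟩ =
      QRep.Infl.toGr (monomialInfl hd hf hx hfx) := by
  obtain ⟨c, hc, h⟩ := Projectivization.exists_rep_smul (K := K) hx
  exact toGr_monomialInfl_smul hd hf _ _ _ _ hc h.symm

/-- Injectivity is that of the Veronese embedding. Surjectivity is the recovery of a point from the
arrows of an inflation. -/
theorem pointGr_bijective (hd : 0 < d) (hf : ∀ i, (f i).IsHomogeneous d) :
    Function.Bijective (pointGr hd hf) := by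
  constructor
  · intro x y hxy
    have h2 := congrArg (fun U => U.1.carrier .two) hxy
    have h3 : (K ∙ monomials d x.1.rep) = K ∙ monomials d y.1.rep :=
      (monomialInfl_carrier_two hd hf _ _).symm.trans
        (h2.trans (monomialInfl_carrier_two hd hf _ _))
    have h4 : monomials d x.1.rep ∈ K ∙ monomials d y.1.rep :=
      h3 ▸ Submodule.mem_span_singleton_self _
    obtain ⟨c, hc⟩ := Submodule.mem_span_singleton.1 h4
    obtain ⟨b, hb⟩ := eq_smul_of_monomials_eq_smul hd x.1.rep_nonzero hc.symm
    refine Subtype.ext ?_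
    rw [← x.1.mk_rep, ← y.1.mk_rep, Projectivization.mk_eq_mk_iff']
    exact ⟨b, hb.symm⟩
  · intro U
    obtain ⟨p, rfl⟩ := QRep.Infl.toGr_surjective _ _ U
    obtain ⟨hx, hfx, h⟩ := arrowScalars_spec hd hf p
    exact ⟨_, (pointGr_mk hd hf hx hfx).trans h.symm⟩

/-- Reineke's isomorphism. -/
noncomputable def reineke (hd : 0 < d) (hf : ∀ i, (f i).IsHomogeneous d) :
    QRep.Gr dimVec (eqnRep d f) ≃ projVariety f :=
  (Equiv.ofBijective _ (pointGr_bijective hd hf)).symm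

theorem pointGr_reineke (hd : 0 < d) (hf : ∀ i, (f i).IsHomogeneous d)
    (U : QRep.Gr dimVec (eqnRep d f)) : pointGr hd hf (reineke hd hf U) = U :=
  (Equiv.ofBijective _ (pointGr_bijective hd hf)).apply_symm_apply U

/-- On inflations the map is induced by a linear map, which makes it a morphism on the quotient. -/
theorem reineke_toGr (hd : 0 < d) (hf : ∀ i, (f i).IsHomogeneous d)
    (p : QRep.Infl dimVec (eqnRep d f)) (hx : arrowScalars f p.1 ≠ 0) :
    (reineke hd hf (QRep.Infl.toGr p)).1 = Projectivization.mk K (arrowScalars f p.1) hx := by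
  obtain ⟨hx, hfx, h⟩ := arrowScalars_spec hd hf p
  rw [h, ← pointGr_mk hd hf hx hfx]
  exact congrArg Subtype.val
    ((Equiv.ofBijective _ (pointGr_bijective hd hf)).symm_apply_apply _)

theorem subspaceOfPP_isLocal (Y : Set (PP K n)) : (subspaceOfPP Y).IsLocal :=
  projSpace_isLocal.induced _

theorem isMor_reineke (hd : 0 < d) (hf : ∀ i, (f i).IsHomogeneous d) :
    IsMor (QRep.grSpace dimVec (eqnRep d f)) (subspaceOfPP (projVariety f)) (reineke hd hf) := by
  refine .to_induced (QRep.grSpace_isLocal _ _) (.of_comp_coinduced ?_)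
  let ψ : QRep.Infl dimVec (eqnRep d f) → {x : Fin (n + 1) → K // x ≠ 0} :=
    fun p => ⟨arrowScalars f p.1, (arrowScalars_spec hd hf p).1⟩
  have : (Subtype.val ∘ reineke hd hf) ∘ QRep.Infl.toGr = Projectivization.mk' K ∘ ψ :=
    funext fun p => reineke_toGr hd hf p _
  rw [this]
  exact isMor_mk'.comp (.to_induced (affineSpace_isLocal.induced _)
    (isMor_of_linear (arrowScalars f) fun _ => rfl))

theorem polyFun_monomials (l : Module.Dual K (Exps n d → K)) :
    (fun x => l (monomials d x)) ∈ polyFun K (Fin (n + 1) → K) := by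
  have : (fun x => l (monomials d x)) = ∑ m : Exps n d,
      l (Pi.single m 1) • ∏ i, (fun x : Fin (n + 1) → K => x i) ^ m.1 i := by
    funext x
    conv_lhs => rw [pi_eq_sum_univ' (monomials d x)]
    simp [monomials, mul_comm]
  rw [this]
  have hX : ∀ i, (fun x : Fin (n + 1) → K => x i) ∈ polyFun K (Fin (n + 1) → K) := fun i =>
    polyFun_dual (LinearMap.proj i : (Fin (n + 1) → K) →ₗ[K] K)
  exact sum_mem fun m _ => Subalgebra.smul_mem _ (prod_mem fun i _ => pow_mem (hX i) _) _

theorem isMor_monomials (f : Fin k → MvPolynomial (Fin (n + 1)) K) :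
    IsMor (affineSpace K (Fin (n + 1) → K))
      (affineSpace K (QRep.Space K (Vert n k) dimVec ×
        (∀ i : Vert n k, (Fin (dimVec i) → K) →ₗ[K] (eqnRep d f).obj i)))
      fun x => (arrowSpace K n k x, embSpace d f (monomials d x, monomials (d - 1) x)) := by
  refine isMor_of_polyFun fun l => ?_
  let l' := l ∘ₗ (arrowSpace K n k).prodMap (embSpace d f)
  have : (fun x => l (arrowSpace K n k x, embSpace d f (monomials d x, monomials (d - 1) x))) =
      (fun x => (l' ∘ₗ LinearMap.inl K _ _) x) +
      ((fun x => (l' ∘ₗ LinearMap.inr K _ _ ∘ₗ LinearMap.inl K _ _) (monomials d x)) +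
      (fun x => (l' ∘ₗ LinearMap.inr K _ _ ∘ₗ LinearMap.inr K _ _) (monomials (d - 1) x))) := by
    funext x
    simp only [Pi.add_apply, LinearMap.comp_apply, ← map_add]
    simp [l']
  rw [this]
  exact add_mem (polyFun_dual _) (add_mem (polyFun_monomials _) (polyFun_monomials _))

theorem isMor_pointGr (hd : 0 < d) (hf : ∀ i, (f i).IsHomogeneous d) :
    IsMor (subspaceOfPP (projVariety f)) (QRep.grSpace dimVec (eqnRep d f)) (pointGr hd hf) := by
  -- `pointGr` is defined through the arbitrary representative `rep`. On each chart the normalized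
  -- representative yields the same subrepresentation and a regular lift to inflations.
  refine .of_cover (subspaceOfPP_isLocal _)
    (fun j : Fin (n + 1) => Subtype.val ⁻¹' affineChart K j)
    (fun j => ⟨_, isOpen_affineChart j, rfl⟩) (fun x => exists_mem_affineChart x.1) fun j => ?_
  let S : Set (projVariety f) := Subtype.val ⁻¹' affineChart K j
  have hne : ∀ x : S, normalizedRep j x.1.1 ≠ 0 := fun x =>
    smul_ne_zero (inv_ne_zero x.2) x.1.1.rep_nonzero
  have hz : ∀ x : S, ∀ i, MvPolynomial.eval (normalizedRep j x.1.1) (f i) = 0 := fun x i =>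
    (eval_smul_eq_zero_iff (hf i) (inv_ne_zero x.2) _).2 (x.1.2 i)
  let lift : S → QRep.Infl dimVec (eqnRep d f) := fun x => monomialInfl hd hf (hne x) (hz x)
  have hlift : pointGr hd hf ∘ Subtype.val = QRep.Infl.toGr ∘ lift := funext fun x =>
    (toGr_monomialInfl_smul hd hf x.1.1.rep_nonzero x.1.2 (hne x) (hz x)
      (inv_ne_zero x.2) rfl).symm
  have hloc : ((subspaceOfPP (projVariety f)).induced (Subtype.val : S → _)).IsLocal :=
    (subspaceOfPP_isLocal _).induced _
  have hchart : IsMor ((subspaceOfPP (projVariety f)).induced (Subtype.val : S → _))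
      ((projSpace K (Fin (n + 1) → K)).induced (Subtype.val : affineChart K j → _))
      (fun x => ⟨x.1.1, x.2⟩) := by
    have hval := (isMor_induced (projSpace K (Fin (n + 1) → K)) Subtype.val).comp
      (isMor_induced (subspaceOfPP (projVariety f)) (Subtype.val : S → _))
    exact .to_induced hloc hval
  rw [hlift]
  exact (isMor_coinduced _ _).comp (.to_induced hloc
    ((isMor_monomials f).comp ((isMor_normalizedRep j).comp hchart)))

theorem isIso_reineke (hd : 0 < d) (hf : ∀ i, (f i).IsHomogeneous d) :
    IsIso (QRep.grSpace dimVec (eqnRep d f)) (subspaceOfPP (projVariety f)) (reineke hd hf) :=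
  .of_isMor (isMor_reineke hd hf) (isMor_pointGr hd hf)

theorem veronese_reineke (hd : 0 < d) (hf : ∀ i, (f i).IsHomogeneous d)
    (U : QRep.Gr dimVec (eqnRep d f)) :
    (veronese d (reineke hd hf U).1).submodule = U.1.carrier Vert.two := by
  conv_rhs => rw [← pointGr_reineke hd hf U]
  exact (Projectivization.submodule_mk _ _).trans (monomialInfl_carrier_two hd hf _ _).symm

/-- The quotient is automatically orthogonal, being a quotient of `V`. A morphism `U → W` sends the
generators at 2 and 3 to the same multiple `c` of the vectors of monomials, and vanishing at vertex
1 imposes `c * h j x = 0` for all `j`. -/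
theorem pointGr_mem_grSub_iff (hd : 0 < d) (hf : ∀ i, (f i).IsHomogeneous d)
    (hh : ∀ i, (h i).IsHomogeneous d) (hfh : QRep.HomZero (eqnRep d f) (eqnRep d h))
    (x : projVariety f) :
    pointGr hd hf x ∈ QRep.grSub (QRep.leftPerp (eqnRep d h)) dimVec (eqnRep d f) ↔
      x ∈ nonVanishing (projVariety f) h := by
  set U := pointGr hd hf x
  have h1 : U.1.carrier .one = ⊥ := U.carrier_one
  have h2 : U.1.carrier .two = K ∙ monomials d x.1.rep := monomialInfl_carrier_two hd hf _ _
  have h3 : U.1.carrier .three = K ∙ monomials (d - 1) x.1.rep :=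
    monomialInfl_carrier_three hd hf _ _
  have hquot : QRep.leftPerp (eqnRep d h) U.1.quot :=
    QRep.leftPerp_of_surjective U.1.mkQ (fun i => Submodule.mkQ_surjective _) hfh
  have m2 : monomials d x.1.rep ∈ U.1.carrier .two := h2 ▸ Submodule.mem_span_singleton_self _
  have m3 : monomials (d - 1) x.1.rep ∈ U.1.carrier .three :=
    h3 ▸ Submodule.mem_span_singleton_self _
  have key2 : ∀ y : Exps n d → K, y ∈ U.1.carrier .two →
      ∃ c : K, c • monomials d x.1.rep = y := by
    intro y hy
    rw [h2] at hy
    exact Submodule.mem_span_singleton.1 hy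
  have key3 : ∀ y : Exps n (d - 1) → K, y ∈ U.1.carrier .three →
      ∃ c : K, c • monomials (d - 1) x.1.rep = y := by
    intro y hy
    rw [h3] at hy
    exact Submodule.mem_span_singleton.1 hy
  constructor
  · rintro ⟨hsub, -⟩
    by_contra hx
    have hx' : ∀ j, MvPolynomial.eval x.1.rep (h j) = 0 := by
      by_contra! h0
      exact hx h0
    have hcoeff : ∀ (c : K) (j : Fin k), coeffForm n d (h j) (c • monomials d x.1.rep) = 0 := by
      intro c j
      rw [map_smul, coeffForm_monomials (hh j), hx', smul_zero]
    -- `V` and `W` coincide at vertices 2 and 3 and on the arrows between them, so the inclusion of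
    -- `U` also maps to `W`. The vanishing of all `h j` at `x` gives compatibility with the arrows
    -- `2 → 1`.
    let φ : QRep.Hom U.1.toRep (eqnRep d h) :=
      { app := fun i => match i with
          | .one => (0 : U.1.carrier .one →ₗ[K] (Unit → K))
          | .two => (U.1.carrier .two).subtype
          | .three => (U.1.carrier .three).subtype
        comm := by
          rintro (_ | _ | _) (_ | _ | _) a y
          · exact nomatch a
          · exact nomatch a
          · exact nomatch a
          · obtain ⟨c, hc⟩ := key2 y.1 y.2
            exact funext fun _ => ((congrArg _ hc).symm.trans (hcoeff c a)).symm
          · exact nomatch a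
          · rfl
          · exact nomatch a
          · exact nomatch a
          · exact nomatch a }
    exact monomials_ne_zero d x.1.rep_nonzero (LinearMap.congr_fun (hsub φ .two) ⟨_, m2⟩)
  · rintro ⟨a, ha⟩
    refine ⟨fun φ => ?_, hquot⟩
    let v : Exps n d → K := φ.app .two ⟨_, m2⟩
    let w : Exps n (d - 1) → K := φ.app .three ⟨_, m3⟩
    have hvw : ∀ j, lowerMap K n d j v = x.1.rep j • w := by
      intro j
      refine (φ.comm (Vert.arrowThree j) ⟨_, m2⟩).symm.trans ?_
      refine Eq.trans ?_ (map_smul (φ.app .three) (x.1.rep j) ⟨_, m3⟩)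
      exact congrArg (φ.app .three) (Subtype.ext (lowerMap_monomials hd x.1.rep j))
    have hone : Subsingleton (U.1.carrier .one) := by
      rw [h1]
      infer_instance
    have hv : coeffForm n d (h a) v = 0 := by
      have := φ.comm (Vert.arrowOne a) ⟨_, m2⟩
      have h0 : U.1.toRep.map (Vert.arrowOne a) ⟨_, m2⟩ = 0 := hone.elim _ _
      rw [h0, map_zero] at this
      exact (congrFun this ()).symm
    obtain ⟨c, hc2, hc3⟩ := eq_smul_monomials hd x.1.rep_nonzero hvw
    have hc : c = 0 := by
      rw [hc2, map_smul, coeffForm_monomials (hh a)] at hv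
      exact (smul_eq_zero.1 hv).resolve_right ha
    subst hc
    rw [zero_smul] at hc2 hc3
    rintro (_ | _ | _)
    · refine LinearMap.ext fun y => ?_
      have h0 : y = 0 := hone.elim _ _
      rw [h0, map_zero, map_zero]
    · refine LinearMap.ext fun y => ?_
      obtain ⟨c, hc⟩ := key2 y.1 y.2
      have h0 : y = c • (⟨_, m2⟩ : U.1.carrier .two) := Subtype.ext hc.symm
      rw [h0]
      refine (map_smul (φ.app .two) c _).trans ?_
      exact (congrArg (c • ·) hc2).trans (smul_zero c)
    · refine LinearMap.ext fun y => ?_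
      obtain ⟨c, hc⟩ := key3 y.1 y.2
      have h0 : y = c • (⟨_, m3⟩ : U.1.carrier .three) := Subtype.ext hc.symm
      rw [h0]
      refine (map_smul (φ.app .three) c _).trans ?_
      exact (congrArg (c • ·) hc3).trans (smul_zero c)

theorem isOpen_nonVanishing (hh : ∀ i, (h i).IsHomogeneous d) (X : Set (PP K n)) :
    IsOpen[(subspaceOfPP X).top] (nonVanishing X h) := by
  have hset : nonVanishing X h =
      ⋃ j, Subtype.val ⁻¹' {x : PP K n | MvPolynomial.eval x.rep (h j) ≠ 0} := by
    ext x
    simp [nonVanishing]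
  rw [hset]
  let := (subspaceOfPP X).top
  refine isOpen_iUnion fun j => ⟨_, isOpen_preimage_mk' (polyFun_eval (h j)) ?_, rfl⟩
  exact fun v hv => not_congr (eval_rep_mk_eq_zero_iff (hh j) hv)

theorem reineke_mem_iff (hd : 0 < d) (hf : ∀ i, (f i).IsHomogeneous d)
    (hh : ∀ i, (h i).IsHomogeneous d) (hfh : QRep.HomZero (eqnRep d f) (eqnRep d h))
    (U : QRep.Gr dimVec (eqnRep d f)) :
    U ∈ QRep.grSub (QRep.leftPerp (eqnRep d h)) dimVec (eqnRep d f) ↔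
      reineke hd hf U ∈ nonVanishing (projVariety f) h := by
  rw [← pointGr_mem_grSub_iff hd hf hh hfh, pointGr_reineke]

theorem isOpen_grSub (hd : 0 < d) (hf : ∀ i, (f i).IsHomogeneous d)
    (hh : ∀ i, (h i).IsHomogeneous d) (hfh : QRep.HomZero (eqnRep d f) (eqnRep d h)) :
    IsOpen[(QRep.grSpace dimVec (eqnRep d f)).top]
      (QRep.grSub (QRep.leftPerp (eqnRep d h)) dimVec (eqnRep d f)) := by
  have := (isMor_reineke hd hf).isOpen _ (isOpen_nonVanishing hh (projVariety f))
  convert this using 1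
  ext U
  exact reineke_mem_iff hd hf hh hfh U

/-- The restriction of Reineke's isomorphism to the Grassmannian of the left orthogonal category. -/
noncomputable def reinekeRestrict (hd : 0 < d) (hf : ∀ i, (f i).IsHomogeneous d)
    (hh : ∀ i, (h i).IsHomogeneous d) (hfh : QRep.HomZero (eqnRep d f) (eqnRep d h)) :
    QRep.grSub (QRep.leftPerp (eqnRep d h)) dimVec (eqnRep d f) ≃ nonVanishing (projVariety f) h :=
  (reineke hd hf).subtypeEquiv (reineke_mem_iff hd hf hh hfh)

theorem isIso_reinekeRestrict (hd : 0 < d) (hf : ∀ i, (f i).IsHomogeneous d)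
    (hh : ∀ i, (h i).IsHomogeneous d) (hfh : QRep.HomZero (eqnRep d f) (eqnRep d h)) :
    IsIso (QRep.grSubSpace (QRep.leftPerp (eqnRep d h)) dimVec (eqnRep d f))
      ((subspaceOfPP (projVariety f)).induced Subtype.val) (reinekeRestrict hd hf hh hfh) :=
  (isIso_reineke hd hf).restrict (QRep.grSpace_isLocal _ _) (subspaceOfPP_isLocal _) fun _ => rfl

end Reineke

/-! ### Linear projections of projective spaces -/

section LinearProjection

variable {K : Type u} [Field K] {E : Type*} [AddCommGroup E] [Module K E] {ι : Type*}

theorem map_rep_ne_zero_iff {F : Type*} [AddCommGroup F] [Module K F] (L : E →ₗ[K] F) {v : E}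
    (hv : v ≠ 0) : L (Projectivization.mk K v hv).rep ≠ 0 ↔ L v ≠ 0 := by
  obtain ⟨c, hc, h⟩ := Projectivization.exists_rep_smul (K := K) hv
  rw [← h, map_smul]
  simp [hc]

theorem mk_map_rep_mk {F : Type*} [AddCommGroup F] [Module K F] (L : E →ₗ[K] F) {v : E}
    (hv : v ≠ 0) (h : L (Projectivization.mk K v hv).rep ≠ 0) (h' : L v ≠ 0) :
    Projectivization.mk K (L (Projectivization.mk K v hv).rep) h =
      Projectivization.mk K (L v) h' := by
  obtain ⟨c, hc, hcv⟩ := Projectivization.exists_rep_smul (K := K) hv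
  rw [Projectivization.mk_eq_mk_iff']
  exact ⟨c, by rw [← hcv, map_smul]⟩

/-- Linear projection is a morphism off its centre, and `h` says that `i` avoids the centre. The
proof factors through the open set `D` where the projection is defined. -/
theorem isMor_mk_map (L : E →ₗ[K] (ι → K)) {S : Type*} {A : FunSpace K S} (hA : A.IsLocal)
    {i : S → ℙ K E} (hi : IsMor A (projSpace K E) i) (h : ∀ s, L (i s).rep ≠ 0) :
    IsMor A (projSpace K (ι → K)) fun s => Projectivization.mk K (L (i s).rep) (h s) := by
  let D : Set (ℙ K E) := {x | L x.rep ≠ 0}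
  have hD : IsOpen[(projSpace K E).top] D := by
    have hU : D = ⋃ a, {x | L x.rep a ≠ 0} := by
      ext x
      rw [Set.mem_iUnion]
      exact Function.ne_iff
    rw [hU]
    let := (projSpace K E).top
    refine isOpen_iUnion fun a => ?_
    let l : E →ₗ[K] K := LinearMap.proj a ∘ₗ L
    exact isOpen_preimage_mk' (polyFun_dual l) fun v hv => map_rep_ne_zero_iff l hv
  have hφ : IsMor ((projSpace K E).induced (Subtype.val : D → ℙ K E)) (projSpace K (ι → K))
      fun x => Projectivization.mk K (L x.1.rep) x.2 := by
    refine .of_comp_coinduced_restrict (affineSpace_isLocal.induced _) hD ?_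
    let ψ : Projectivization.mk' K ⁻¹' D → {x : ι → K // x ≠ 0} := fun v =>
      ⟨L v.1.1, (map_rep_ne_zero_iff L v.1.2).1 v.2⟩
    have hψ : (fun v : Projectivization.mk' K ⁻¹' D =>
        Projectivization.mk K (L (Projectivization.mk' K v.1).rep) v.2) =
        Projectivization.mk' K ∘ ψ :=
      funext fun v => mk_map_rep_mk L v.1.2 _ _
    rw [hψ]
    exact isMor_mk'.comp (.to_induced ((affineSpace_isLocal.induced _).induced _)
      (.of_induced_comp affineSpace_isLocal (isMor_of_linear L fun _ => rfl)))
  have hiD : IsMor A ((projSpace K E).induced (Subtype.val : D → ℙ K E)) fun s => ⟨i s, h s⟩ :=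
    .to_induced hA hi
  exact hφ.comp hiD

end LinearProjection

/-! ### Closed subsets of projective space -/

section Closed

open MvPolynomial

variable {K : Type u} [Field K]

/-- The values of the components at `x` are the coefficients of the polynomial `t ↦ P (t • x)`,
which has infinitely many roots. -/
theorem eval_homogeneousComponent_eq_zero [Infinite K] {n : ℕ}
    {P : MvPolynomial (Fin (n + 1)) K} {x : Fin (n + 1) → K}
    (h : ∀ t : K, t ≠ 0 → eval (t • x) P = 0) (i : ℕ) :
    eval x (homogeneousComponent i P) = 0 := by
  let p : Polynomial K := ∑ j ∈ Finset.range (P.totalDegree + 1),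
    Polynomial.monomial j (eval x (homogeneousComponent j P))
  have hp : ∀ t : K, t ≠ 0 → p.eval t = 0 := by
    intro t ht
    rw [← h t ht]
    conv_rhs => rw [← sum_homogeneousComponent P]
    simp only [p, Polynomial.eval_finsetSum, map_sum, Polynomial.eval_monomial]
    refine Finset.sum_congr rfl fun j _ => ?_
    rw [mul_comm]
    exact (eval_smul_of_isHomogeneous (homogeneousComponent_isHomogeneous j P) t x).symm
  have hp0 : p = 0 := by
    refine Polynomial.eq_zero_of_infinite_isRoot p
      (Set.Infinite.mono (s := {0}ᶜ) (fun t ht => hp t ht) (Set.finite_singleton 0).infinite_compl)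
  by_cases hi : i ≤ P.totalDegree
  · have := congrArg (Polynomial.coeff · i) hp0
    simpa [p, Polynomial.finsetSum_coeff, Polynomial.coeff_monomial, Nat.lt_succ_iff, hi] using this
  · rw [homogeneousComponent_eq_zero _ _ (not_le.1 hi), map_zero]

/-- A closed subset of projective space is the zero set of finitely many forms, all of the same
degree, which can be any sufficiently large number. -/
theorem exists_forms_of_isClosed [Infinite K] {n : ℕ} {C : Set (PP K n)}
    (hC : IsOpen[(projSpace K (Fin (n + 1) → K)).top] Cᶜ) :
    ∃ D₀ : ℕ, ∀ D ≥ D₀, ∃ (a : ℕ) (F : Fin a → MvPolynomial (Fin (n + 1)) K),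
      (∀ i, (F i).IsHomogeneous D) ∧ projVariety F = C := by
  obtain ⟨O, hO, hOC⟩ := hC
  -- The vanishing ideal of the punctured cone over `C`. It contains the homogeneous components of
  -- its elements and, by Hilbert's basis theorem, is finitely generated.
  let I : Ideal (MvPolynomial (Fin (n + 1)) K) :=
    { carrier := {P | ∀ v (hv : v ≠ 0), Projectivization.mk K v hv ∈ C → eval v P = 0}
      add_mem' := fun hP hQ v hv hvC => by rw [map_add, hP v hv hvC, hQ v hv hvC, add_zero]
      zero_mem' := fun v _ _ => map_zero _
      smul_mem' := fun Q P hP v hv hvC => by rw [smul_eq_mul, map_mul, hP v hv hvC, mul_zero] }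
  have hIC : ∀ x : PP K n, (∀ P ∈ I, eval x.rep P = 0) → x ∈ C := by
    intro x hx
    by_contra hxC
    have hmem : ∀ v (hv : v ≠ 0), v ∈ O ↔ Projectivization.mk K v hv ∉ C := fun v hv =>
      Set.ext_iff.1 hOC ⟨v, hv⟩
    obtain ⟨p, hp, hpx, hpO⟩ := exists_polyFun_of_isOpen hO x.rep
      ((hmem _ x.rep_nonzero).2 (by rwa [x.mk_rep]))
    obtain ⟨P, hP⟩ := exists_eval_of_polyFun hp
    refine hpx ((hP _).trans (hx P fun v hv hvC => ?_))
    by_contra h0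
    exact (hmem v hv).1 (hpO v (by rwa [hP])) hvC
  have hcomp : ∀ P ∈ I, ∀ i, homogeneousComponent i P ∈ I := by
    refine fun P hP i v hv hvC => eval_homogeneousComponent_eq_zero (fun t ht => ?_) i
    refine hP _ (smul_ne_zero ht hv) ?_
    convert hvC using 1
    rw [Projectivization.mk_eq_mk_iff']
    exact ⟨t, rfl⟩
  obtain ⟨s, hs⟩ := (isNoetherianRing_iff_ideal_fg _).1 inferInstance I
  have hsI : ∀ P ∈ s, P ∈ I := fun P hP => hs ▸ Ideal.subset_span hP
  refine ⟨s.sup totalDegree, fun D hD => ?_⟩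
  -- Multiplying a component of degree `i` by `X_j ^ (D - i)` for every `j` brings all forms to
  -- degree `D`. The zero set is unchanged, since some coordinate is nonzero at each point.
  let σ := s × Fin (s.sup totalDegree + 1) × Fin (n + 1)
  let G : σ → MvPolynomial (Fin (n + 1)) K := fun a =>
    X a.2.2 ^ (D - a.2.1) * homogeneousComponent a.2.1 a.1.1
  refine ⟨Fintype.card σ, G ∘ (Fintype.equivFin σ).symm, fun i => ?_, ?_⟩
  · obtain ⟨a, ha⟩ : ∃ a, (Fintype.equivFin σ).symm i = a := ⟨_, rfl⟩
    have hD' : (a.2.1 : ℕ) ≤ D := (Nat.lt_succ_iff.1 a.2.1.2).trans hD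
    rw [Function.comp_apply, ha]
    have := (isHomogeneous_X_pow a.2.2 (D - a.2.1)).mul
      (homogeneousComponent_isHomogeneous (R := K) a.2.1 a.1.1)
    rwa [Nat.sub_add_cancel hD'] at this
  · ext x
    constructor
    · intro hx
      have hx' : ∀ a, eval x.rep (G a) = 0 := fun a => by
        have := hx (Fintype.equivFin σ a)
        rwa [Function.comp_apply, Equiv.symm_apply_apply] at this
      obtain ⟨j, hj⟩ := Function.ne_iff.1 x.rep_nonzero
      have hsx : ∀ P ∈ s, eval x.rep P = 0 := by
        intro P hP
        rw [← sum_homogeneousComponent P, map_sum]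
        refine Finset.sum_eq_zero fun i hi => ?_
        have hi' : i < s.sup totalDegree + 1 :=
          (Finset.mem_range.1 hi).trans_le (Nat.succ_le_succ (Finset.le_sup hP))
        have := hx' (⟨P, hP⟩, ⟨i, hi'⟩, j)
        rw [map_mul, map_pow, eval_X] at this
        exact (mul_eq_zero.1 this).resolve_left (pow_ne_zero _ hj)
      refine hIC x fun P hP => ?_
      have hle : I ≤ RingHom.ker (eval x.rep) := by
        rw [← hs, Ideal.span_le]
        exact hsx
      exact hle hP
    · intro hx i
      have : G ((Fintype.equivFin σ).symm i) ∈ I :=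
        I.mul_mem_left _ (hcomp _ (hsI _ (Subtype.prop _)) _)
      exact this _ x.rep_nonzero (by rwa [x.mk_rep])

end Closed

/-! ### Quasi-projective varieties as Grassmannians -/

theorem Vert.card (n k : ℕ) : Nat.card (Vert n k) = 3 := by
  let e : Vert n k ≃ Fin 3 :=
    { toFun := fun v => match v with | .one => 0 | .two => 1 | .three => 2
      invFun := ![.one, .two, .three]
      left_inv := by rintro (_ | _ | _) <;> rfl
      right_inv := by
        intro i
        fin_cases i <;> rfl }
  rw [Nat.card_congr e, Nat.card_fin]

theorem Vert.finite_hom {n k : ℕ} : ∀ i j : Vert n k, Finite (i ⟶ j)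
  | .two, .three => inferInstanceAs (Finite (Fin (n + 1)))
  | .two, .one => inferInstanceAs (Finite (Fin k))
  | .one, _ => inferInstanceAs (Finite Empty)
  | .three, _ => inferInstanceAs (Finite Empty)
  | .two, .two => inferInstanceAs (Finite Empty)

theorem Vert.eq_two_of_hom {n k : ℕ} : ∀ {i j : Vert n k}, (i ⟶ j) → i = .two ∧ j ≠ .two
  | .two, .three, _ => ⟨rfl, nofun⟩
  | .two, .one, _ => ⟨rfl, nofun⟩
  | .one, _, a => nomatch a
  | .three, _, a => nomatch a
  | .two, .two, a => nomatch a

/-- Arrows lead from vertex 2 to other vertices, so a path of positive length never returns to its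
start. -/
theorem Vert.path_length_eq_zero {n k : ℕ} (i : Vert n k) (p : Quiver.Path i i) :
    p.length = 0 := by
  have key : ∀ {j : Vert n k} (p : Quiver.Path i j), p.length = 0 ∨ (i = .two ∧ j ≠ .two) := by
    intro j p
    induction p with
    | nil => exact Or.inl rfl
    | cons q a ih =>
      obtain ⟨h1, h2⟩ := Vert.eq_two_of_hom a
      rcases ih with h | h
      · exact Or.inr ⟨(Quiver.Path.eq_of_length_zero q h).trans h1, h2⟩
      · exact absurd h1 h.2
  exact (key p).resolve_right fun h => h.2 h.1

section QuasiProjective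

open MvPolynomial

variable {K : Type u} [Field K]

/-- Every locally closed subset of projective space is isomorphic to a set of the form
`V(f) ∩ ⋃ D(h j)` for forms of the same positive degree that fulfil a non-degeneracy condition. -/
theorem exists_forms_of_isLocallyClosed [Infinite K] {n : ℕ} {Y : Set (PP K n)}
    (hY : @IsLocallyClosed _ (projSpace K (Fin (n + 1) → K)).top Y) :
    ∃ (N k D : ℕ) (f h : Fin k → MvPolynomial (Fin (N + 1)) K), 0 < D ∧
      (∀ i, (f i).IsHomogeneous D) ∧ (∀ i, (h i).IsHomogeneous D) ∧ f ≠ 0 ∧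
      (∀ c : K, h ≠ c • f) ∧
      ∃ ε : nonVanishing (projVariety f) h ≃ Y,
        IsIso ((subspaceOfPP (projVariety f)).induced Subtype.val) (subspaceOfPP Y) ε := by
  let := (projSpace K (Fin (n + 1) → K)).top
  obtain ⟨U, Z, hU, hZ, rfl⟩ := hY
  obtain ⟨D₁, hD₁⟩ := exists_forms_of_isClosed hZ.isOpen_compl
  obtain ⟨D₂, hD₂⟩ := exists_forms_of_isClosed (C := Uᶜ) (by rwa [compl_compl])
  -- The maximum gives one common degree for both families, and the added one makes it positive.
  obtain ⟨a, F, hF, rfl⟩ := hD₁ (max D₁ D₂ + 1) (by omega)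
  obtain ⟨b, H, hH, hHU⟩ := hD₂ (max D₁ D₂ + 1) (by omega)
  obtain ⟨D, hD⟩ : ∃ D, max D₁ D₂ + 1 = D := ⟨_, rfl⟩
  rw [hD] at hF hH
  have hDpos : 0 < D := by omega
  have hmemU : ∀ x, x ∈ U ↔ ∃ i, eval x.rep (H i) ≠ 0 := by
    intro x
    rw [← not_iff_not, ← Set.mem_compl_iff, ← hHU]
    simp [projVariety]
  let T : MvPolynomial (Fin (n + 1 + 1)) K := X (Fin.last (n + 1)) ^ D
  have hT : T ≠ 0 := pow_ne_zero _ (X_ne_zero _)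
  have hTD : T.IsHomogeneous D := isHomogeneous_X_pow _ _
  have hTz : ∀ z, eval z T = 0 ↔ z (Fin.last (n + 1)) = 0 := fun z => by
    rw [map_pow, eval_X, pow_eq_zero_iff hDpos.ne']
  -- `Y` is placed in the hyperplane where the new last coordinate is zero. `T` occurs in `f'` at an
  -- index where `h'` is zero, and in `h'` at an index where `f'` is zero, so `f'` is nonzero and
  -- `h'` is no multiple of it. As `T` vanishes on the hyperplane, it adds nothing to the union of
  -- the open sets of `h'`. Zeros pad both families to the same length.
  let σ := Bool ⊕ Fin a ⊕ Fin b
  let f' : σ → MvPolynomial (Fin (n + 1 + 1)) K :=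
    Sum.elim (fun t => if t then T else 0) (Sum.elim (fun i => rename Fin.castSucc (F i)) 0)
  let h' : σ → MvPolynomial (Fin (n + 1 + 1)) K :=
    Sum.elim (fun t => if t then 0 else T) (Sum.elim 0 fun i => rename Fin.castSucc (H i))
  let e := Fintype.equivFin σ
  have hzero : (0 : MvPolynomial (Fin (n + 1 + 1)) K).IsHomogeneous D := isHomogeneous_zero _ _ _
  have hf : ∀ i, ((f' ∘ e.symm) i).IsHomogeneous D := by
    intro i
    change (f' (e.symm i)).IsHomogeneous D
    rcases e.symm i with (_ | _) | i | i
    exacts [hzero, hTD, (hF i).rename_isHomogeneous, hzero]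
  have hh : ∀ i, ((h' ∘ e.symm) i).IsHomogeneous D := by
    intro i
    change (h' (e.symm i)).IsHomogeneous D
    rcases e.symm i with (_ | _) | i | i
    exacts [hTD, hzero, hzero, (hH i).rename_isHomogeneous]
  have hf0 : f' ∘ e.symm ≠ 0 := by
    intro h0
    have := congrFun h0 (e (Sum.inl true))
    rw [Function.comp_apply, Equiv.symm_apply_apply] at this
    exact hT this
  have hhf : ∀ c : K, h' ∘ e.symm ≠ c • (f' ∘ e.symm) := by
    intro c h0
    have h1 := congrFun h0 (e (Sum.inl true))
    have h2 := congrFun h0 (e (Sum.inl false))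
    rw [Pi.smul_apply, Function.comp_apply, Function.comp_apply, Equiv.symm_apply_apply] at h1 h2
    have h3 : T = c • 0 := h2
    exact hT (h3.trans (smul_zero c))
  let pr : (Fin (n + 1 + 1) → K) →ₗ[K] (Fin (n + 1) → K) := LinearMap.funLeft K K Fin.castSucc
  let inc : (Fin (n + 1) → K) →ₗ[K] (Fin (n + 1 + 1) → K) :=
    LinearMap.pi (Fin.lastCases 0 fun i => LinearMap.proj i)
  have hinc_last : ∀ y, inc y (Fin.last (n + 1)) = 0 := fun y => by simp [inc]
  have hpr_inc : ∀ y, pr (inc y) = y := fun y => by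
    funext i
    simp [pr, inc, LinearMap.funLeft_apply]
  have hinc_pr : ∀ z, z (Fin.last (n + 1)) = 0 → inc (pr z) = z := fun z hz => by
    funext i
    refine Fin.lastCases ?_ (fun i => ?_) i
    · rw [hinc_last, hz]
    · simp [pr, inc, LinearMap.funLeft_apply]
  have hren : ∀ z P, eval z (rename Fin.castSucc P) = eval (pr z) P := fun z P =>
    eval_rename _ _ _
  have hX : ∀ z, (∀ i, eval z ((f' ∘ e.symm) i) = 0) ↔
      z (Fin.last (n + 1)) = 0 ∧ ∀ i, eval (pr z) (F i) = 0 := by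
    intro z
    constructor
    · intro hz
      refine ⟨?_, fun i => ?_⟩
      · have h1 := hz (e (Sum.inl true))
        rw [Function.comp_apply, Equiv.symm_apply_apply] at h1
        have h2 : eval z T = 0 := h1
        exact (hTz z).1 h2
      · have h1 := hz (e (Sum.inr (Sum.inl i)))
        rw [Function.comp_apply, Equiv.symm_apply_apply] at h1
        exact (hren _ _).symm.trans h1
    · rintro ⟨hl, hz⟩ i
      change eval z (f' (e.symm i)) = 0
      rcases e.symm i with (_ | _) | i | i
      · exact map_zero _
      · exact (hTz z).2 hl
      · exact (hren _ _).trans (hz i)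
      · exact map_zero _
  have hN : ∀ z, z (Fin.last (n + 1)) = 0 →
      ((∃ i, eval z ((h' ∘ e.symm) i) ≠ 0) ↔ ∃ i, eval (pr z) (H i) ≠ 0) := by
    intro z hz
    constructor
    · rintro ⟨i, hi⟩
      change eval z (h' (e.symm i)) ≠ 0 at hi
      generalize e.symm i = t at hi
      rcases t with (_ | _) | i | i
      · exact absurd ((hTz z).2 hz) hi
      · exact absurd (map_zero _) hi
      · exact absurd (map_zero _) hi
      · exact ⟨i, fun h0 => hi ((hren _ _).trans h0)⟩
    · rintro ⟨i, hi⟩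
      refine ⟨e (Sum.inr (Sum.inr i)), fun h0 => hi ?_⟩
      rw [Function.comp_apply, Equiv.symm_apply_apply] at h0
      exact (hren _ _).symm.trans h0
  refine ⟨n + 1, _, D, f' ∘ e.symm, h' ∘ e.symm, hDpos, hf, hh, hf0, hhf, ?_⟩
  let N := nonVanishing (projVariety (f' ∘ e.symm)) (h' ∘ e.symm)
  have hlast : ∀ s : N, s.1.1.rep (Fin.last (n + 1)) = 0 := fun s => ((hX _).1 s.1.2).1
  have hdown : ∀ s : N, pr s.1.1.rep ≠ 0 := fun s h0 => s.1.1.rep_nonzero (by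
    rw [← hinc_pr _ (hlast s), h0, map_zero])
  have hup : ∀ y : ↥(U ∩ projVariety F), inc y.1.rep ≠ 0 := fun y h0 => y.1.rep_nonzero (by
    rw [← hpr_inc y.1.rep, h0, map_zero])
  have hdownY : ∀ s : N, Projectivization.mk K _ (hdown s) ∈ U ∩ projVariety F := by
    intro s
    refine ⟨(hmemU _).2 ?_, mk_mem_projVariety hF _ ((hX _).1 s.1.2).2⟩
    obtain ⟨i, hi⟩ := (hN _ (hlast s)).1 s.2
    exact ⟨i, fun h0 => hi ((eval_rep_mk_eq_zero_iff (hH i) _).1 h0)⟩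
  have hupX : ∀ y : ↥(U ∩ projVariety F),
      Projectivization.mk K _ (hup y) ∈ projVariety (f' ∘ e.symm) := fun y =>
    mk_mem_projVariety hf _ ((hX _).2 ⟨hinc_last _, by
      rw [hpr_inc]
      exact y.2.2⟩)
  have hupN : ∀ y, (⟨_, hupX y⟩ : projVariety (f' ∘ e.symm)) ∈ N := by
    intro y
    have h1 := (hN (inc y.1.rep) (hinc_last _)).2 (by
      rw [hpr_inc]
      exact (hmemU _).1 y.2.1)
    obtain ⟨i, hi⟩ := h1
    exact ⟨i, fun h0 => hi ((eval_rep_mk_eq_zero_iff (hh i) _).1 h0)⟩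
  -- Both directions are induced by linear maps: forgetting the last coordinate, and adjoining a
  -- zero.
  let ε : N ≃ ↥(U ∩ projVariety F) :=
    { toFun := fun s => ⟨_, hdownY s⟩
      invFun := fun y => ⟨⟨_, hupX y⟩, hupN y⟩
      left_inv := by
        intro s
        refine Subtype.ext (Subtype.ext ?_)
        have h1 : inc (pr s.1.1.rep) = s.1.1.rep := hinc_pr _ (hlast s)
        refine (mk_map_rep_mk inc (hdown s) (hup ⟨_, hdownY s⟩) ?_).trans ?_
        · rw [h1]
          exact s.1.1.rep_nonzero
        · simp only [h1]
          exact s.1.1.mk_rep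
      right_inv := by
        intro y
        refine Subtype.ext ?_
        have h1 : pr (inc y.1.rep) = y.1.rep := hpr_inc _
        refine (mk_map_rep_mk pr (hup y) (hdown ⟨⟨_, hupX y⟩, hupN y⟩) ?_).trans ?_
        · rw [h1]
          exact y.1.rep_nonzero
        · simp only [h1]
          exact y.1.mk_rep }
  have hloc : ((subspaceOfPP (projVariety (f' ∘ e.symm))).induced
      (Subtype.val : N → _)).IsLocal := (subspaceOfPP_isLocal _).induced _
  have hval := (isMor_induced (projSpace K (Fin (n + 1 + 1) → K)) Subtype.val).comp
    (isMor_induced (subspaceOfPP (projVariety (f' ∘ e.symm))) (Subtype.val : N → _))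
  refine ⟨ε, .of_isMor (.to_induced hloc (isMor_mk_map pr hloc hval hdown))
    (.to_induced (subspaceOfPP_isLocal _) (.to_induced (subspaceOfPP_isLocal _) ?_))⟩
  exact isMor_mk_map inc (subspaceOfPP_isLocal _) (isMor_induced _ _) hup

end QuasiProjective

/-! ### The theorem -/

theorem theorem4 {K : Type u} [Field K] [IsAlgClosed K] :
    (∀ (n k d : ℕ) (f h : Fin k → MvPolynomial (Fin (n + 1)) K), 0 < d →
      (∀ i, (f i).IsHomogeneous d) → (∀ j, (h j).IsHomogeneous d) →
      f ≠ 0 → (∀ c : K, h ≠ c • f) →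
      (eqnRep d f).IsBrick ∧ (eqnRep d h).IsBrick ∧
      QRep.HomZero (eqnRep d f) (eqnRep d h) ∧ QRep.HomZero (eqnRep d h) (eqnRep d f) ∧
      QRep.IsOpenFullyExact (QRep.leftPerp (eqnRep d h)) ∧
      QRep.leftPerp (eqnRep d h) (eqnRep d f) ∧
      ∃ Φ : QRep.Gr dimVec (eqnRep d f) ≃ projVariety f,
        FunSpace.IsIso (QRep.grSpace dimVec (eqnRep d f)) (subspaceOfPP (projVariety f)) Φ ∧
        (∀ U : QRep.Gr dimVec (eqnRep d f),
          (veronese d (Φ U).1).submodule = U.1.carrier Vert.two) ∧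
        IsOpen[(QRep.grSpace dimVec (eqnRep d f)).top]
          (QRep.grSub (QRep.leftPerp (eqnRep d h)) dimVec (eqnRep d f)) ∧
        IsOpen[(subspaceOfPP (projVariety f)).top] (nonVanishing (projVariety f) h) ∧
        ∃ Ψ : QRep.grSub (QRep.leftPerp (eqnRep d h)) dimVec (eqnRep d f) ≃
            nonVanishing (projVariety f) h,
          (∀ U, (Ψ U).1 = Φ U.1) ∧
          FunSpace.IsIso (QRep.grSubSpace (QRep.leftPerp (eqnRep d h)) dimVec (eqnRep d f))
            ((subspaceOfPP (projVariety f)).induced Subtype.val) Ψ) ∧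
    (∀ (n : ℕ) (Y : Set (PP K n)),
      @IsLocallyClosed _ (projSpace K (Fin (n + 1) → K)).top Y →
      ∃ (Q : Type) (_ : Quiver.{0} Q) (V W : QRep K Q) (e : Q → ℕ),
        Nat.card Q = 3 ∧ (∀ i j : Q, Finite (i ⟶ j)) ∧
        (∀ (i : Q) (p : Quiver.Path i i), p.length = 0) ∧
        V.IsBrick ∧ W.IsBrick ∧ (∀ i, e i ≤ 1) ∧
        QRep.IsOpenFullyExact (QRep.leftPerp W) ∧ QRep.leftPerp W V ∧
        ∃ Θ : QRep.grSub (QRep.leftPerp W) e V ≃ Y,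
          FunSpace.IsIso (QRep.grSubSpace (QRep.leftPerp W) e V) (subspaceOfPP Y) Θ) := by
  refine ⟨fun n k d f h hd hf hh hf0 hfh => ?_, fun n Y hY => ?_⟩
  · have hVW := eqnRep_homZero hd hf hh hf0 hfh
    have hh0 : h ≠ 0 := by
      rw [← zero_smul K f]
      exact hfh 0
    exact ⟨eqnRep_isBrick hd hf hf0, eqnRep_isBrick hd hh hh0, hVW,
      eqnRep_homZero_symm hd hf hh hf0 hfh, QRep.isOpenFullyExact_leftPerp _, hVW,
      reineke hd hf, isIso_reineke hd hf, veronese_reineke hd hf, isOpen_grSub hd hf hh hVW,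
      isOpen_nonVanishing hh _, reinekeRestrict hd hf hh hVW, fun _ => rfl,
      isIso_reinekeRestrict hd hf hh hVW⟩
  · obtain ⟨N, k, D, f, h, hd, hf, hh, hf0, hfh, ε, hε⟩ := exists_forms_of_isLocallyClosed hY
    have hVW := eqnRep_homZero hd hf hh hf0 hfh
    have hh0 : h ≠ 0 := by
      rw [← zero_smul K f]
      exact hfh 0
    exact ⟨Vert N k, inferInstance, eqnRep D f, eqnRep D h, dimVec, Vert.card N k,
      Vert.finite_hom, Vert.path_length_eq_zero, eqnRep_isBrick hd hf hf0,
      eqnRep_isBrick hd hh hh0, by rintro (_ | _ | _) <;> simp [dimVec],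
      QRep.isOpenFullyExact_leftPerp _, hVW, (reinekeRestrict hd hf hh hVW).trans ε,
      (isIso_reinekeRestrict hd hf hh hVW).trans hε⟩
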